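/- Let $n\ge 0$ and $l$ be integers with $2l>n$, and let $V(x)=\sum_{q\in\mathbb Z^n}v_q e^{i\langle q,x\rangle}$ be a real trigonometric polynomial on $\mathbb R^n$ (finitely many $v_q\ne0$, $v_{-q}=\overline{v_q}$) with $v_0=0$. Notation. $K=[0,1)^n$; $P_j(t)=j+t$ and $p_j(t)=|P_j(t)|$ for $j\in\mathbb Z^n$, $t\in\mathbb R^n$; $\mathcal K:\mathbb R^n\to K$ is the map $\mathcal K P_j(t)=t$ for $t\in K$. For $k>0$, $\delta>0$ and $q\in\mathbb Z^n$, the resonant set $\chi_q(k,\delta)$ consists of all $t$ in the image under $\mathcal K$ of $\{x\in\mathbb R^n: |x|=k,\ \big||x|^2-|x-q|^2\big|<4k^{-n+2-\delta}\}$ for which there is a $j\in\mathbb Z^n$ (a resonant index of $t$) with $$p_j(t)=k,\qquad |p_{j-q}^2(t)-p_j^2(t)|<k^{-n+2-\delta},\qquad |p_j^2(t)-p_i^2(t)|>2k^{-n+2-6\delta}\ \text{ for all } i\ne j,\,j-q .$$ For $t\in K$ and $j\in\mathbb Z^n$ let $$\hat\lambda^+(t)=\tfrac12\big(p_j^{2l}(t)+p_{j-q}^{2l}(t)\big)+\tfrac12\Big(4|v_q|^2+\big(p_j^{2l}(t)-p_{j-q}^{2l}(t)\big)^2\Big)^{1/2}$$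 be the larger eigenvalue of the model matrix $\begin{pmatrix}p_j^{2l}(t)&v_q\\ v_{-q}&p_{j-q}^{2l}(t)\end{pmatrix}$, let $\hat e^+=(p_{j-q}^{2l}(t)-\hat\lambda^+(t),\,-v_{-q})^T$ be a corresponding eigenvector, let $\hat E^+=\hat e^+(\hat e^+)^*/|\hat e^+|^2$ be the spectral projection, with rows and columns indexed by $j,\,j-q$, and let $$\psi_{-1}(x)=\hat E^+_{j,j}+\hat E^+_{j-q,j}\,e^{-i\langle q,x\rangle}.$$ For a function $f$ on $\mathbb R^n$ that is $2\pi$-periodic in each variable, $\|f\|_*$ is the sum of the absolute values of its Fourier coefficients. Theorem. There is a constant $\hat c=\hat c(V,l)>0$, and for every $\delta$ with $0<9\delta<2l-n$ there is a $k_0=k_0(V,l,\delta)\ge1$, such that the following holds for all $k>k_0$ and all $q$ with $v_q\ne0$. Let $t\in K$ lie at distance less than $k^{-n+1-7\delta}$ from a point $t_0\in\chi_q(k,\delta)$, let $j$ be a resonant index of $t_0$, let $\gamma_2>0$, and let $\sigma\in\mathbb R$, $A\in\mathbb C$ satisfy $|\sigma||A|^2<k^{-2l\gamma_2}$. Put $\gamma=\min\{\gamma_1,2l\gamma_2\}$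 with $2\gamma_1=2l-n-8\delta$. Then there are a function $u\in C^{2l}(\mathbb R^n)$ and a real number $\lambda$ with $$(-\Delta)^l u+Vu+\sigma|u|^2u=\lambda u\quad\text{in }\mathbb R^n,$$ $$\frac{\partial^m u}{\partial x_s^m}(x+2\pi e_s)=e^{2\pi i t_s}\frac{\partial^m u}{\partial x_s^m}(x)\qquad(x\in\mathbb R^n,\ 1\le s\le n,\ 0\le m\le 2l-1),$$ such that $$u(x)=A\,e^{i\langle P_j(t),x\rangle}\big(\psi_{-1}(x)+\hat u(x)\big),\qquad |\lambda-\hat\lambda^+(t)|\le\hat c\,k^{-\gamma},$$ where $\hat u$ is continuous, $2\pi$-periodic in each variable, and $\|\hat u\|_*\le\hat c\,k^{-\gamma}$. -/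

import Mathlib

open scoped ENNReal

noncomputable section

namespace Polyharmonic

/-- The lattice vector `j ∈ ℤⁿ`, seen in `ℝⁿ`. -/
def latticePoint {n : ℕ} (j : Fin n → ℤ) : EuclideanSpace ℝ (Fin n) :=
  WithLp.toLp 2 (fun i => (j i : ℝ))

/-- `P_j(t) = j + t`. -/
def shiftedPoint {n : ℕ} (j : Fin n → ℤ) (t : EuclideanSpace ℝ (Fin n)) :
    EuclideanSpace ℝ (Fin n) :=
  latticePoint j + t

/-- The elementary cell `K = [0,1)ⁿ` of the dual lattice. -/
def dualCell (n : ℕ) : Set (EuclideanSpace ℝ (Fin n)) :=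
  {t | ∀ i, t i ∈ Set.Ico (0 : ℝ) 1}

/-- The map `𝒦 : ℝⁿ → K`, `𝒦 (P_j(t)) = t`. -/
def toDualCell {n : ℕ} (x : EuclideanSpace ℝ (Fin n)) : EuclideanSpace ℝ (Fin n) :=
  WithLp.toLp 2 (fun i => Int.fract (x i))

/-- The eigenvalue `p_j^{2l}(t) = |P_j(t)|^{2l}` of the free operator `H₀(t)`. -/
def freeEigenvalue {n : ℕ} (l : ℕ) (j : Fin n → ℤ) (t : EuclideanSpace ℝ (Fin n)) : ℝ :=
  ‖shiftedPoint j t‖ ^ (2 * l)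

/-- The plane wave `x ↦ e^{i⟨p, x⟩}`. -/
def planeWave {n : ℕ} (p x : EuclideanSpace ℝ (Fin n)) : ℂ :=
  Complex.exp (Complex.I * ((inner ℝ p x : ℝ) : ℂ))

/-- The trigonometric polynomial `V(x) = ∑_q v_q e^{i⟨q, x⟩}` with coefficients `v`. -/
def potential {n : ℕ} (v : (Fin n → ℤ) →₀ ℂ) (x : EuclideanSpace ℝ (Fin n)) : ℂ :=
  v.sum (fun q a => a * planeWave (latticePoint q) x)

/-- The spherical layer
`S_q(k, ε) = {x : |x| = k, | |x|² - |x - q|² | < 4 k^{-ε}}`. -/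
def sphericalLayer {n : ℕ} (q : Fin n → ℤ) (k ε : ℝ) : Set (EuclideanSpace ℝ (Fin n)) :=
  {x | ‖x‖ = k ∧ |‖x‖ ^ 2 - ‖x - latticePoint q‖ ^ 2| < 4 * k ^ (-ε)}

/-- `j` is a resonant index for the quasimomentum `t`: the point `P_j(t)` is on the sphere of
radius `k`, `p_{j-q}²(t)` is close to `p_j²(t)`, and all the other `p_i²(t)` are away from it. -/
structure IsResonantIndex {n : ℕ} (q : Fin n → ℤ) (k δ : ℝ) (t : EuclideanSpace ℝ (Fin n))
    (j : Fin n → ℤ) : Prop where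
  norm_eq : ‖shiftedPoint j t‖ = k
  close : |‖shiftedPoint (j - q) t‖ ^ 2 - ‖shiftedPoint j t‖ ^ 2| < k ^ (-(n : ℝ) + 2 - δ)
  far : ∀ i : Fin n → ℤ, i ≠ j → i ≠ j - q →
    2 * k ^ (-(n : ℝ) + 2 - 6 * δ) < |‖shiftedPoint j t‖ ^ 2 - ‖shiftedPoint i t‖ ^ 2|

/-- The resonant set `χ_q(k, δ)`, a subset of `𝒦 S_q(k, n - 2 + δ) ⊆ K`. -/
def resonantSet {n : ℕ} (q : Fin n → ℤ) (k δ : ℝ) : Set (EuclideanSpace ℝ (Fin n)) :=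
  {t | t ∈ toDualCell '' sphericalLayer q k ((n : ℝ) - 2 + δ) ∧
    ∃ j : Fin n → ℤ, IsResonantIndex q k δ t j}

/-- The larger eigenvalue `λ̂⁺(t)` of the model matrix
`!![p_j^{2l}(t), v_q; v_{-q}, p_{j-q}^{2l}(t)]` (for `v_{-q}` conjugate to `v_q`). -/
def lambdaPlus {n : ℕ} (l : ℕ) (v : (Fin n → ℤ) →₀ ℂ) (q j : Fin n → ℤ)
    (t : EuclideanSpace ℝ (Fin n)) : ℝ :=
  (freeEigenvalue l j t + freeEigenvalue l (j - q) t) / 2 +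
    Real.sqrt (4 * ‖v q‖ ^ 2 + (freeEigenvalue l j t - freeEigenvalue l (j - q) t) ^ 2) / 2

/-- The eigenvector `ê⁺ = (p_{j-q}^{2l}(t) - λ̂⁺(t), -v_{-q})` of the model matrix. -/
def modelEigenvector {n : ℕ} (l : ℕ) (v : (Fin n → ℤ) →₀ ℂ) (q j : Fin n → ℤ)
    (t : EuclideanSpace ℝ (Fin n)) : Fin 2 → ℂ :=
  ![((freeEigenvalue l (j - q) t - lambdaPlus l v q j t : ℝ) : ℂ), -v (-q)]

/-- The block of `Ê⁺(t)` with indices in `{j, j - q}` (in this order), that is, the orthogonal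
projection `ê ê* / |ê|²` onto the line spanned by `ê = ê⁺`; all other entries of `Ê⁺(t)` are `0`. -/
def modelProjection {n : ℕ} (l : ℕ) (v : (Fin n → ℤ) →₀ ℂ) (q j : Fin n → ℤ)
    (t : EuclideanSpace ℝ (Fin n)) : Matrix (Fin 2) (Fin 2) ℂ :=
  ((∑ a, ‖modelEigenvector l v q j t a‖ ^ 2 : ℝ) : ℂ)⁻¹ •
    Matrix.vecMulVec (modelEigenvector l v q j t) (star (modelEigenvector l v q j t))

/-- `ψ₋₁(x) = Ê⁺(t)_{j,j} + Ê⁺(t)_{j-q,j} e^{-i⟨q, x⟩}`, so that `e^{i⟨P_j(t), x⟩} ψ₋₁(x)` is the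
combination of the plane waves with wave vectors `P_j(t)`, `P_{j-q}(t)` whose coefficients are the
column of `Ê⁺(t)` with index `j`. -/
def psiModel {n : ℕ} (l : ℕ) (v : (Fin n → ℤ) →₀ ℂ) (q j : Fin n → ℤ)
    (t x : EuclideanSpace ℝ (Fin n)) : ℂ :=
  modelProjection l v q j t 0 0 +
    modelProjection l v q j t 1 0 * planeWave (-latticePoint q) x

/-- `(-Δ)^l u`. -/
def polyLaplacian {n : ℕ} (l : ℕ) (u : EuclideanSpace ℝ (Fin n) → ℂ) :
    EuclideanSpace ℝ (Fin n) → ℂ :=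
  (fun f : EuclideanSpace ℝ (Fin n) → ℂ => -Laplacian.laplacian f)^[l] u

/-- `u` is a classical solution in `ℝⁿ` of `(-Δ)^l u + V u + σ |u|² u = lam u`. -/
def IsSolution {n : ℕ} (l : ℕ) (V : EuclideanSpace ℝ (Fin n) → ℂ) (σ lam : ℝ)
    (u : EuclideanSpace ℝ (Fin n) → ℂ) : Prop :=
  ContDiff ℝ (2 * l : ℕ) u ∧
    ∀ x, polyLaplacian l u x + V x * u x + (σ : ℂ) * ((‖u x‖ ^ 2 : ℝ) : ℂ) * u x = (lam : ℂ) * u x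

/-- The quasi-periodic conditions with quasimomentum `t`: for every coordinate direction `s`, `u`
and its derivatives `∂^m u / ∂x_s^m`, `m ≤ 2l - 1`, are multiplied by `e^{2πi t_s}` when `x_s` is
replaced by `x_s + 2π`. -/
def IsQuasiPeriodic {n : ℕ} (l : ℕ) (t : EuclideanSpace ℝ (Fin n))
    (u : EuclideanSpace ℝ (Fin n) → ℂ) : Prop :=
  ∀ (s : Fin n) (m : ℕ), m < 2 * l → ∀ x : EuclideanSpace ℝ (Fin n),
    iteratedFDeriv ℝ m u (x + EuclideanSpace.single s (2 * Real.pi))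
        (fun _ => EuclideanSpace.single s 1) =
      Complex.exp (2 * Real.pi * Complex.I * (t s : ℂ)) *
        iteratedFDeriv ℝ m u x (fun _ => EuclideanSpace.single s 1)

/-- `f` is `2π`-periodic in every coordinate. -/
def IsPeriodic {n : ℕ} (f : EuclideanSpace ℝ (Fin n) → ℂ) : Prop :=
  ∀ (s : Fin n) (x : EuclideanSpace ℝ (Fin n)),
    f (x + EuclideanSpace.single s (2 * Real.pi)) = f x

/-- The Fourier coefficient `(2π)⁻ⁿ ∫_Q f(x) e^{-i⟨b, x⟩} dx`, where `Q = [0, 2π]ⁿ`. -/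
def fourierCoefficient {n : ℕ} (f : EuclideanSpace ℝ (Fin n) → ℂ) (b : Fin n → ℤ) : ℂ :=
  (((2 * Real.pi) ^ n : ℝ) : ℂ)⁻¹ *
    ∫ x in {x : EuclideanSpace ℝ (Fin n) | ∀ i, x i ∈ Set.Icc 0 (2 * Real.pi)},
      f x * planeWave (-latticePoint b) x

/-- `‖f‖_* = ∑_b |f_b|`, the sum of the absolute values of the Fourier coefficients. -/
def starNorm {n : ℕ} (f : EuclideanSpace ℝ (Fin n) → ℂ) : ℝ≥0∞ :=
  ∑' b : Fin n → ℤ, ‖fourierCoefficient f b‖ₑ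

end Polyharmonic

end

noncomputable section

namespace Polyharmonic

/-! Put `u = B e^{i⟨P_j(t), x⟩} ∑ Y_m e^{i⟨m, x⟩}`. With `a_m = p_{j+m}^{2l}(t)` and `τ = σ|B|²` the
equation becomes a nonlinear eigenvalue problem for `Y ∈ ℓ¹(ℤⁿ)`: `(a_m - λ) Y_m + (v * Y)_m + τ
(cubic Y)_m = 0`. The space `ℓ¹` is a convolution algebra whose norm is `‖·‖_*`, so the potential
and the cubic term are bounded and locally Lipschitz there; only the diagonal part is unbounded.

Every `a_m` with `m ≠ 0, -q` lies at distance at least `G`, of order `k^{2l-n-6δ}`, from `a_0`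
(`IsResonantIndex.spectralGap_le`). If `a_{-q} - a_0 ≤ G/4`, then `λ̂⁺` is within `G/2` of `a_0`.
The diagonal part minus `λ̂⁺` is then invertible off the block `{0, -q}` with inverse of size `2/G`,
while on the block the two model eigenvalues differ by at least `2|v_q|`, which is bounded below
because `V` has finitely many coefficients. A Lyapunov–Schmidt reduction and a contraction
(`exists_reduced_solution`, `exists_nonlinear_eigenvector`) give `Y` and `λ` with error `O(1/G +
|τ|)`, and `1/G ≤ k^{-γ₁}`. Symmetry of convolution by a real function makes `λ` real, and the
equation itself makes `|P_{j+m}(t)|^{2l} Y_m` summable, so `u` is a classical solution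
(`isSolution_of_eigenvector`).

If `a_{-q} - a_0 > G/4`, the `j` column of the projection has size `O(1/G)`, and `u = 0`, `û = -ψ₋₁`
satisfies the assertion. Since the constants do not depend on `γ₂`, `|σ||A|²` is only known to be
below `1`; when it is not small, shrinking the amplitude costs a relative error absorbed by a
multiple of `|σ||A|²`. -/

/-! ### The convolution algebra `ℓ¹(ι)` -/

/-- Absolutely summable complex families. -/
abbrev L1 (ι : Type*) := lp (fun _ : ι => ℂ) 1

section L1

variable {ι : Type*}

theorem L1.hasSum_norm (Y : L1 ι) : HasSum (fun m => ‖Y m‖) ‖Y‖ := by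
  simpa using lp.hasSum_norm (p := 1) (by simp) Y

theorem L1.summable_norm (Y : L1 ι) : Summable (fun m => ‖Y m‖) := (L1.hasSum_norm Y).summable

theorem L1.norm_eq (Y : L1 ι) : ‖Y‖ = ∑' m, ‖Y m‖ := (L1.hasSum_norm Y).tsum_eq.symm

theorem L1.norm_apply_le (Y : L1 ι) (m : ι) : ‖Y m‖ ≤ ‖Y‖ :=
  lp.norm_apply_le_norm one_ne_zero Y m

/-- The element of `ℓ¹` with given coordinates. -/
def L1.mk (f : ι → ℂ) (hf : Summable fun m => ‖f m‖) : L1 ι :=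
  ⟨f, memℓp_gen (by simpa using hf)⟩

@[simp]
theorem L1.mk_apply (f : ι → ℂ) (hf : Summable fun m => ‖f m‖) (m : ι) : L1.mk f hf m = f m := rfl

@[simp]
theorem L1.add_apply (Y Z : L1 ι) (m : ι) : (Y + Z) m = Y m + Z m := rfl

@[simp]
theorem L1.sub_apply (Y Z : L1 ι) (m : ι) : (Y - Z) m = Y m - Z m := rfl

@[simp]
theorem L1.neg_apply (Y : L1 ι) (m : ι) : (-Y) m = -Y m := rfl

@[simp]
theorem L1.smul_apply (c : ℂ) (Y : L1 ι) (m : ι) : (c • Y) m = c * Y m := rfl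

@[simp]
theorem L1.zero_apply (m : ι) : (0 : L1 ι) m = 0 := rfl

theorem L1.ext' {Y Z : L1 ι} (h : ∀ m, Y m = Z m) : Y = Z := lp.ext (funext h)

/-- Multiplication of the coordinates by a bounded family. -/
def L1.diag (g : ι → ℂ) (C : ℝ) (hg : ∀ m, ‖g m‖ ≤ C) : L1 ι →L[ℂ] L1 ι :=
  LinearMap.mkContinuous
    { toFun := fun Y => L1.mk (fun m => g m * Y m)
        (Summable.of_nonneg_of_le (fun _ => norm_nonneg _)
          (fun m => by rw [norm_mul]; exact mul_le_mul_of_nonneg_right (hg m) (norm_nonneg _))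
          ((L1.summable_norm Y).mul_left C))
      map_add' := fun Y Z => L1.ext' fun m => by simp [mul_add]
      map_smul' := fun c Y => L1.ext' fun m => by simp [mul_left_comm] }
    C (fun Y => by
      refine hasSum_le (fun m => ?_) (L1.hasSum_norm _) ((L1.hasSum_norm Y).mul_left C)
      simp only [LinearMap.coe_mk, AddHom.coe_mk, L1.mk_apply, norm_mul]
      exact mul_le_mul_of_nonneg_right (hg m) (norm_nonneg _))

@[simp]
theorem L1.diag_apply (g : ι → ℂ) (C : ℝ) (hg : ∀ m, ‖g m‖ ≤ C) (Y : L1 ι) (m : ι) :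
    L1.diag g C hg Y m = g m * Y m := rfl

theorem L1.norm_diag_le (g : ι → ℂ) (C : ℝ) (hC : 0 ≤ C) (hg : ∀ m, ‖g m‖ ≤ C) :
    ‖L1.diag g C hg‖ ≤ C := LinearMap.mkContinuous_norm_le _ hC _

theorem L1.hasSum_apply {α : Type*} {F : α → L1 ι} {Y : L1 ι} (h : HasSum F Y) (p : ι) :
    HasSum (fun a => F a p) (Y p) :=
  h.mapL (lp.evalCLM ℂ (fun _ : ι => ℂ) 1 p)

/-- The pairing `∑ conj(Y_m) Z_m`. -/
def L1.pair (Y Z : L1 ι) : ℂ := ∑' m, (starRingEnd ℂ) (Y m) * Z m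

theorem L1.summable_pair (Y Z : L1 ι) : Summable fun m => (starRingEnd ℂ) (Y m) * Z m := by
  refine Summable.of_norm (Summable.of_nonneg_of_le (fun _ => norm_nonneg _) (fun m => ?_)
    ((L1.summable_norm Z).mul_left ‖Y‖))
  rw [norm_mul, RCLike.norm_conj]
  exact mul_le_mul_of_nonneg_right (L1.norm_apply_le Y m) (norm_nonneg _)

variable [AddCommGroup ι]

/-- Translation by `m`. -/
def L1.shift (m : ι) (Y : L1 ι) : L1 ι :=
  L1.mk (fun p => Y (p - m)) (by
    have h := (Equiv.subRight m).summable_iff.2 (L1.summable_norm Y)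
    simpa only [Function.comp_def, Equiv.subRight_apply] using h)

@[simp]
theorem L1.shift_apply (m : ι) (Y : L1 ι) (p : ι) : L1.shift m Y p = Y (p - m) := rfl

theorem L1.norm_shift (m : ι) (Y : L1 ι) : ‖L1.shift m Y‖ = ‖Y‖ := by
  rw [L1.norm_eq, L1.norm_eq]
  exact (Equiv.subRight m).tsum_eq fun p => ‖Y p‖

theorem L1.shift_add (m : ι) (Y Z : L1 ι) :
    L1.shift m (Y + Z) = L1.shift m Y + L1.shift m Z := rfl

theorem L1.shift_smul (m : ι) (c : ℂ) (Y : L1 ι) :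
    L1.shift m (c • Y) = c • L1.shift m Y := rfl

theorem L1.norm_smul_shift (Y Z : L1 ι) (m : ι) : ‖Y m • L1.shift m Z‖ = ‖Y m‖ * ‖Z‖ := by
  rw [norm_smul, L1.norm_shift]

theorem L1.summable_norm_smul_shift (Y Z : L1 ι) : Summable fun m => ‖Y m • L1.shift m Z‖ := by
  simpa only [L1.norm_smul_shift] using (L1.summable_norm Y).mul_right ‖Z‖

theorem L1.summable_smul_shift (Y Z : L1 ι) : Summable fun m => Y m • L1.shift m Z :=
  (L1.summable_norm_smul_shift Y Z).of_norm

/-- Convolution by `Y`. -/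
def L1.conv (Y : L1 ι) : L1 ι →L[ℂ] L1 ι :=
  LinearMap.mkContinuous
    { toFun := fun Z => ∑' m, Y m • L1.shift m Z
      map_add' := fun Z Z' => by
        rw [← (L1.summable_smul_shift Y Z).tsum_add (L1.summable_smul_shift Y Z')]
        simp only [L1.shift_add, smul_add]
      map_smul' := fun c Z => by
        rw [RingHom.id_apply, ← (L1.summable_smul_shift Y Z).tsum_const_smul]
        simp only [L1.shift_smul, smul_comm c] }
    ‖Y‖ (fun Z => by
      refine (norm_tsum_le_tsum_norm (L1.summable_norm_smul_shift Y Z)).trans_eq ?_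
      simp only [L1.norm_smul_shift, tsum_mul_right, ← L1.norm_eq])

theorem L1.conv_eq (Y Z : L1 ι) : L1.conv Y Z = ∑' m, Y m • L1.shift m Z := rfl

theorem L1.hasSum_conv (Y Z : L1 ι) : HasSum (fun m => Y m • L1.shift m Z) (L1.conv Y Z) :=
  (L1.summable_smul_shift Y Z).hasSum

theorem L1.norm_conv_le (Y : L1 ι) : ‖L1.conv Y‖ ≤ ‖Y‖ :=
  LinearMap.mkContinuous_norm_le _ (norm_nonneg _) _

theorem L1.norm_conv_apply_le (Y Z : L1 ι) : ‖L1.conv Y Z‖ ≤ ‖Y‖ * ‖Z‖ :=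
  (L1.conv Y).le_of_opNorm_le (L1.norm_conv_le Y) Z

theorem L1.conv_add_left (Y Y' Z : L1 ι) : L1.conv (Y + Y') Z = L1.conv Y Z + L1.conv Y' Z := by
  simp only [L1.conv_eq]
  rw [← (L1.summable_smul_shift Y Z).tsum_add (L1.summable_smul_shift Y' Z)]
  simp only [L1.add_apply, add_smul]

theorem L1.conv_smul_left (c : ℂ) (Y Z : L1 ι) : L1.conv (c • Y) Z = c • L1.conv Y Z := by
  simp only [L1.conv_eq]
  rw [← (L1.summable_smul_shift Y Z).tsum_const_smul]
  simp only [L1.smul_apply, mul_smul]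

theorem L1.conv_sub_left (Y Y' Z : L1 ι) : L1.conv (Y - Y') Z = L1.conv Y Z - L1.conv Y' Z := by
  rw [eq_sub_iff_add_eq, ← L1.conv_add_left, sub_add_cancel]

theorem L1.conv_apply (Y Z : L1 ι) (p : ι) : L1.conv Y Z p = ∑' m, Y m * Z (p - m) :=
  (L1.hasSum_apply (L1.hasSum_conv Y Z) p).tsum_eq.symm

theorem L1.conv_comm (Y Z : L1 ι) : L1.conv Y Z = L1.conv Z Y := by
  refine L1.ext' fun p => ?_
  rw [L1.conv_apply, L1.conv_apply, ← (Equiv.subLeft p).tsum_eq]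
  simp [mul_comm]

/-- The sequence of the Fourier coefficients of the complex conjugate function. -/
def L1.refl (Y : L1 ι) : L1 ι :=
  L1.mk (fun p => (starRingEnd ℂ) (Y (-p)))
    (by simpa [Function.comp_def] using (Equiv.neg ι).summable_iff.2 (L1.summable_norm Y))

@[simp]
theorem L1.refl_apply (Y : L1 ι) (p : ι) : L1.refl Y p = (starRingEnd ℂ) (Y (-p)) := rfl

theorem L1.refl_refl (Y : L1 ι) : L1.refl (L1.refl Y) = Y := L1.ext' fun p => by simp

theorem L1.norm_refl (Y : L1 ι) : ‖L1.refl Y‖ = ‖Y‖ := by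
  rw [L1.norm_eq, L1.norm_eq, ← (Equiv.neg ι).tsum_eq fun p => ‖Y p‖]
  simp

theorem L1.refl_sub (Y Z : L1 ι) : L1.refl (Y - Z) = L1.refl Y - L1.refl Z :=
  L1.ext' fun p => by simp

theorem L1.refl_conv (Y Z : L1 ι) :
    L1.refl (L1.conv Y Z) = L1.conv (L1.refl Y) (L1.refl Z) := by
  refine L1.ext' fun p => ?_
  rw [L1.refl_apply, L1.conv_apply, L1.conv_apply, Complex.conj_tsum,
    ← (Equiv.neg ι).tsum_eq fun m => (L1.refl Y) m * (L1.refl Z) (p - m)]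
  refine tsum_congr fun m => ?_
  simp only [map_mul, Equiv.neg_apply, L1.refl_apply, neg_neg, sub_neg_eq_add, neg_add_rev]
  rw [← sub_eq_neg_add]

/-- Fubini: the double series converges absolutely, since `(p, m) ↦ (m, p - m)` carries it to a
product of two `ℓ¹` families, up to the bounded factor `Y p`. -/
theorem L1.pair_conv (W Y Z : L1 ι) :
    L1.pair Y (L1.conv W Z) = ∑' m, W m * L1.pair Y (L1.shift m Z) := by
  have hs : Summable (Function.uncurry fun p m : ι =>
      (starRingEnd ℂ) (Y p) * (W m * Z (p - m))) := by
    have h : Summable fun x : ι × ι => ‖W x.1‖ * ‖Z x.2‖ :=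
      (L1.summable_norm W).mul_of_nonneg (L1.summable_norm Z) (fun _ => norm_nonneg _)
        fun _ => norm_nonneg _
    let φ : ι × ι ≃ ι × ι :=
      { toFun := fun x => (x.2, x.1 - x.2), invFun := fun y => (y.1 + y.2, y.1)
        left_inv := fun x => by simp, right_inv := fun y => by simp }
    have h' := (φ.summable_iff.2 h).mul_left ‖Y‖
    refine Summable.of_norm (Summable.of_nonneg_of_le (fun _ => norm_nonneg _) (fun x => ?_) h')
    simp only [Function.uncurry, norm_mul, RCLike.norm_conj, Function.comp, φ, Equiv.coe_fn_mk]
    exact mul_le_mul_of_nonneg_right (L1.norm_apply_le Y _) (by positivity)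
  simp only [L1.pair, L1.conv_apply, ← tsum_mul_left]
  rw [← hs.tsum_comm]
  refine tsum_congr fun m => tsum_congr fun p => ?_
  simp only [L1.shift_apply]
  ring

theorem L1.conj_pair_shift (Y : L1 ι) (m : ι) :
    (starRingEnd ℂ) (L1.pair Y (L1.shift m Y)) = L1.pair Y (L1.shift (-m) Y) := by
  simp only [L1.pair, L1.shift_apply]
  rw [Complex.conj_tsum, ← (Equiv.addRight m).tsum_eq]
  refine tsum_congr fun p => ?_
  simp [mul_comm]

/-- Convolution by the coefficients of a real function is symmetric. -/
theorem L1.pair_conv_self_im (W Y : L1 ι) (hW : L1.refl W = W) :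
    (L1.pair Y (L1.conv W Y)).im = 0 := by
  rw [← Complex.conj_eq_iff_im, L1.pair_conv, Complex.conj_tsum, ← (Equiv.neg ι).tsum_eq]
  refine tsum_congr fun m => ?_
  have h : (starRingEnd ℂ) (W (-m)) = W m := by
    rw [← L1.refl_apply, hW]
  simp only [map_mul, Equiv.neg_apply, L1.conj_pair_shift, h, neg_neg]

/-- The coefficients of `|f|² f`, for the function `f` with coefficients `Y`. -/
def L1.cubic (Y : L1 ι) : L1 ι := L1.conv (L1.conv Y (L1.refl Y)) Y

/-- The cubic term is the diagonal of a real-trilinear map of norm at most one; the difference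
telescopes, one factor being replaced at a time. -/
theorem L1.norm_cubic_sub_le {Y Z : L1 ι} {ρ : ℝ} (hY : ‖Y‖ ≤ ρ) (hZ : ‖Z‖ ≤ ρ) :
    ‖L1.cubic Y - L1.cubic Z‖ ≤ 3 * ρ ^ 2 * ‖Y - Z‖ := by
  have hρ : 0 ≤ ρ := (norm_nonneg _).trans hY
  have e : L1.cubic Y - L1.cubic Z =
      L1.conv (L1.conv Y (L1.refl Y)) (Y - Z) + L1.conv (L1.conv Y (L1.refl (Y - Z))) Z +
        L1.conv (L1.conv (Y - Z) (L1.refl Z)) Z := by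
    simp only [L1.cubic, map_sub, L1.refl_sub, L1.conv_sub_left]
    abel
  have b : ∀ A B C : L1 ι, ‖L1.conv (L1.conv A (L1.refl B)) C‖ ≤ ‖A‖ * ‖B‖ * ‖C‖ := fun A B C => by
    refine (L1.norm_conv_apply_le _ _).trans (mul_le_mul_of_nonneg_right ?_ (norm_nonneg _))
    exact (L1.norm_conv_apply_le _ _).trans_eq (by rw [L1.norm_refl])
  have hd := norm_nonneg (Y - Z)
  have h1 : ‖Y‖ * ‖Y‖ * ‖Y - Z‖ ≤ ρ * ρ * ‖Y - Z‖ := by gcongr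
  have h2 : ‖Y‖ * ‖Y - Z‖ * ‖Z‖ ≤ ρ * ‖Y - Z‖ * ρ := by gcongr
  have h3 : ‖Y - Z‖ * ‖Z‖ * ‖Z‖ ≤ ‖Y - Z‖ * ρ * ρ := by gcongr
  rw [e]
  refine (norm_add₃_le).trans ?_
  linarith [b Y Y (Y - Z), b Y (Y - Z) Z, b (Y - Z) Z Z]

@[simp]
theorem L1.cubic_zero : L1.cubic (0 : L1 ι) = 0 := by simp [L1.cubic]

end L1

/-! ### The contraction argument -/

/-- The fixed point obeys `‖x‖ ≤ ‖Φ 0‖ + ‖x‖ / 2`, so its size is governed by the data and not by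
the radius `r`. This is what later yields an error proportional to `g + |τ|`. -/
theorem exists_fixedPoint_of_half_lipschitz {X : Type*} [NormedAddCommGroup X] [CompleteSpace X]
    (Φ : X → X) (r : ℝ) (hr : 0 ≤ r) (h0 : ‖Φ 0‖ ≤ r / 2)
    (hL : ∀ x y, ‖x‖ ≤ r → ‖y‖ ≤ r → ‖Φ x - Φ y‖ ≤ 1 / 2 * ‖x - y‖) :
    ∃ x, ‖x‖ ≤ r ∧ ‖x‖ ≤ 2 * ‖Φ 0‖ ∧ Φ x = x := by
  have hmaps : Set.MapsTo Φ (Metric.closedBall 0 r) (Metric.closedBall 0 r) := fun x hx => by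
    rw [mem_closedBall_zero_iff] at hx ⊢
    have h1 := hL x 0 hx (by simpa using hr)
    have h2 := norm_add_le (Φ x - Φ 0) (Φ 0)
    rw [sub_add_cancel] at h2
    rw [sub_zero] at h1
    linarith
  have hc : ContractingWith (1 / 2 : NNReal) (hmaps.restrict Φ _ _) := by
    refine ⟨by norm_num, LipschitzWith.of_dist_le_mul fun x y => ?_⟩
    have := hL x y (mem_closedBall_zero_iff.1 x.2) (mem_closedBall_zero_iff.1 y.2)
    simpa [Subtype.dist_eq, dist_eq_norm] using this
  obtain ⟨x, hx, hfix, -⟩ := hc.exists_fixedPoint' Metric.isClosed_closedBall.isComplete hmaps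
    (x := (0 : X)) (by simpa using hr) (edist_ne_top _ _)
  rw [mem_closedBall_zero_iff] at hx
  refine ⟨x, hx, ?_, hfix⟩
  have h1 := hL x 0 hx (by simpa using hr)
  have h2 := norm_add_le (Φ x - Φ 0) (Φ 0)
  rw [sub_add_cancel, hfix.eq] at h2
  rw [sub_zero, hfix.eq] at h1
  linarith

section Reduction

variable {X : Type*} [NormedAddCommGroup X] [NormedSpace ℂ X] [CompleteSpace X]

set_option maxHeartbeats 1000000 in
/-- Lyapunov–Schmidt reduction for an eigenvector `e + z₁ + z₂` of a perturbed operator: `Rf` is the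
reduced resolvent of the model on the degenerate block, `Rr` the (small) one off the block. -/
theorem exists_reduced_solution (V Rf Rr : X →L[ℂ] X) (φ : X →L[ℂ] ℂ) (N : X → X) (e : X) (τ : ℂ)
    (ν C g : ℝ) (hν : 1 ≤ ν) (hC : 1 ≤ C) (hg0 : 0 ≤ g)
    (hV : ‖V‖ ≤ ν) (hRf : ‖Rf‖ ≤ C) (hRr : ‖Rr‖ ≤ g) (hφ : ‖φ‖ ≤ 1) (he : ‖e‖ ≤ 2)
    (hN : ∀ x y, ‖x‖ ≤ 3 → ‖y‖ ≤ 3 → ‖N x - N y‖ ≤ 27 * ‖x - y‖) (hN0 : N 0 = 0)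
    (hg : 3072 * (C ^ 2 * ν ^ 3 * g) ≤ 1) (hτ : 8000 * (C ^ 2 * ν * ‖τ‖) ≤ 1) :
    ∃ (z₁ z₂ : X) (μ : ℂ),
      μ = φ (V z₂ + τ • N (e + (z₁ + z₂))) ∧
      z₁ = Rf (μ • (z₁ + z₂) - V z₂ - τ • N (e + (z₁ + z₂))) ∧
      z₂ = Rr (μ • (z₁ + z₂) - V (e + (z₁ + z₂)) - τ • N (e + (z₁ + z₂))) ∧
      ‖z₁ + z₂‖ ≤ 216 * C * ν ^ 3 * (g + ‖τ‖) ∧ ‖μ‖ ≤ 216 * C * ν ^ 3 * (g + ‖τ‖) := by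
  obtain ⟨t, ht⟩ : ∃ t, ‖τ‖ = t := ⟨_, rfl⟩
  have ht0 : 0 ≤ t := ht ▸ norm_nonneg _
  rw [ht] at hτ ⊢
  have hC0 : 0 < C := by linarith
  have hν0 : 0 < ν := by linarith
  have hCν : 0 < C * ν := by positivity
  have hCν1 : 1 ≤ C * ν := one_le_mul_of_one_le_of_one_le hC hν
  -- The coupling of `z₂` into `z₁` through `Rf ∘ V` has size `Cν`, which is not small. Working with
  -- `M z₂` in place of `z₂` divides it by `M`, and the smallness of `g` pays for the factor `M` in
  -- the other component.
  obtain ⟨M, hM⟩ : ∃ M : ℝ, M = 8 * (C * ν) := ⟨_, rfl⟩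
  have hM0 : 0 < M := by rw [hM]; positivity
  have hM1 : 1 ≤ M := by linarith
  -- This radius makes the quadratic term `μ Z` contribute `4Cνr = 1/8`, and `M` makes the coupling
  -- `Cν/M = 1/8`; the terms in `t` fit in the rest of the Lipschitz budget `1/2`.
  obtain ⟨r, hr⟩ : ∃ r : ℝ, r = 1 / (32 * (C * ν)) := ⟨_, rfl⟩
  have hr0 : 0 < r := by rw [hr]; positivity
  have hCνr : C * ν * r = 1 / 32 := by rw [hr]; field_simp
  have hr32 : r ≤ 1 / 32 := by nlinarith
  have hνr : ν * r ≤ 1 / 32 := by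
    have : ν * r ≤ C * (ν * r) := le_mul_of_one_le_left (by positivity) hC
    linarith
  have hCνt : 4000 * (C * ν * t) ≤ 1 := by
    have : C * ν * t ≤ C * (C * ν * t) := le_mul_of_one_le_left (by positivity) hC
    nlinarith
  have hCt : 4000 * (C * t) ≤ 1 := by
    have : C * t ≤ ν * (C * t) := le_mul_of_one_le_left (by positivity) hν
    nlinarith
  have ht1 : 4000 * t ≤ 1 := by
    have : t ≤ C * t := le_mul_of_one_le_left (by positivity) hC
    linarith
  have hMg : 1536 * (C * ν * ν * M * g) ≤ 8 := by rw [hM]; nlinarith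
  have hνMg : 192 * (M * g * ν) ≤ 1 := by
    have : M * g * ν ≤ (C * ν) * (M * g * ν) := le_mul_of_one_le_left (by positivity) hCν1
    nlinarith
  let z : X × X → X := fun ζ => (M⁻¹ : ℂ) • ζ.2
  let Z : X × X → X := fun ζ => ζ.1 + z ζ
  let μ : X × X → ℂ := fun ζ => φ (V (z ζ) + τ • N (e + Z ζ))
  let F₁ : X × X → X := fun ζ => μ ζ • Z ζ - V (z ζ) - τ • N (e + Z ζ)
  let F₂ : X × X → X := fun ζ => μ ζ • Z ζ - V (e + Z ζ) - τ • N (e + Z ζ)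
  let Φ : X × X → X × X := fun ζ => (Rf (F₁ ζ), (M : ℂ) • Rr (F₂ ζ))
  have hnM : ‖(M : ℂ)‖ = M := by rw [Complex.norm_real, Real.norm_of_nonneg hM0.le]
  have hnM' : ‖((M : ℂ))⁻¹‖ = M⁻¹ := by rw [norm_inv, hnM]
  have hMi : M⁻¹ ≤ 1 := inv_le_one_of_one_le₀ hM1
  have hz_sub : ∀ ζ ξ, ‖z ζ - z ξ‖ ≤ M⁻¹ * ‖ζ - ξ‖ := fun ζ ξ => by
    simp only [z]
    rw [← smul_sub, norm_smul, hnM']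
    exact mul_le_mul_of_nonneg_left (norm_snd_le (ζ - ξ)) (by positivity)
  have hz_sub' : ∀ ζ ξ, ‖z ζ - z ξ‖ ≤ ‖ζ - ξ‖ := fun ζ ξ =>
    (hz_sub ζ ξ).trans (mul_le_of_le_one_left (norm_nonneg _) hMi)
  have hZ_sub : ∀ ζ ξ, ‖Z ζ - Z ξ‖ ≤ 2 * ‖ζ - ξ‖ := fun ζ ξ => by
    have h1 : Z ζ - Z ξ = (ζ - ξ).1 + (z ζ - z ξ) := by simp only [Z, Prod.fst_sub]; abel
    rw [h1]
    linarith [norm_add_le (ζ - ξ).1 (z ζ - z ξ), norm_fst_le (ζ - ξ), hz_sub' ζ ξ]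
  have hz0 : z 0 = 0 := by simp [z]
  have hZ0 : Z 0 = 0 := by simp [Z, hz0]
  have hZ_le : ∀ ζ, ‖Z ζ‖ ≤ 2 * ‖ζ‖ := fun ζ => by simpa [hZ0] using hZ_sub ζ 0
  have hz_le : ∀ ζ, ‖z ζ‖ ≤ ‖ζ‖ := fun ζ => by simpa [hz0] using hz_sub' ζ 0
  have hball : ∀ ζ, ‖ζ‖ ≤ r → ‖e + Z ζ‖ ≤ 3 := fun ζ hζ => by
    linarith [norm_add_le e (Z ζ), hZ_le ζ]
  have hVle : ∀ x, ‖V x‖ ≤ ν * ‖x‖ := V.le_of_opNorm_le hV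
  have hNle : ∀ x, ‖x‖ ≤ 3 → ‖N x‖ ≤ 27 * ‖x‖ := fun x hx => by
    simpa [hN0] using hN x 0 hx (by simp)
  have hτN : ∀ ζ, ‖ζ‖ ≤ r → ‖τ • N (e + Z ζ)‖ ≤ 81 * t := fun ζ hζ => by
    rw [norm_smul, ht]
    have h1 := hNle _ (hball ζ hζ)
    have h2 := hball ζ hζ
    nlinarith
  have hτN_sub : ∀ ζ ξ, ‖ζ‖ ≤ r → ‖ξ‖ ≤ r →
      ‖τ • N (e + Z ζ) - τ • N (e + Z ξ)‖ ≤ 54 * t * ‖ζ - ξ‖ := fun ζ ξ hζ hξ => by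
    rw [← smul_sub, norm_smul, ht]
    have h1 := hN _ _ (hball ζ hζ) (hball ξ hξ)
    rw [add_sub_add_left_eq_sub] at h1
    have h2 := hZ_sub ζ ξ
    have h3 : ‖N (e + Z ζ) - N (e + Z ξ)‖ ≤ 54 * ‖ζ - ξ‖ := by linarith
    calc t * _ ≤ t * (54 * ‖ζ - ξ‖) := mul_le_mul_of_nonneg_left h3 ht0
      _ = _ := by ring
  have hφle : ∀ x, ‖φ x‖ ≤ ‖x‖ := fun x => by simpa using φ.le_of_opNorm_le hφ x
  have hμ_le : ∀ ζ, ‖ζ‖ ≤ r → ‖μ ζ‖ ≤ ν * ‖ζ‖ + 81 * t := fun ζ hζ => by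
    refine (hφle _).trans ((norm_add_le _ _).trans (add_le_add ((hVle _).trans ?_) (hτN ζ hζ)))
    exact mul_le_mul_of_nonneg_left (hz_le ζ) hν0.le
  have hμ_sub : ∀ ζ ξ, ‖ζ‖ ≤ r → ‖ξ‖ ≤ r → ‖μ ζ - μ ξ‖ ≤ (ν + 54 * t) * ‖ζ - ξ‖ :=
      fun ζ ξ hζ hξ => by
    simp only [μ]
    rw [← map_sub, add_sub_add_comm, ← map_sub]
    refine (hφle _).trans ((norm_add_le _ _).trans ?_)
    rw [add_mul]
    refine add_le_add ((hVle _).trans ?_) (hτN_sub ζ ξ hζ hξ)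
    exact mul_le_mul_of_nonneg_left (hz_sub' ζ ξ) hν0.le
  have hμZ_sub : ∀ ζ ξ, ‖ζ‖ ≤ r → ‖ξ‖ ≤ r →
      ‖μ ζ • Z ζ - μ ξ • Z ξ‖ ≤ (4 * (ν * r) + 216 * t) * ‖ζ - ξ‖ := fun ζ ξ hζ hξ => by
    have h1 : μ ζ • Z ζ - μ ξ • Z ξ = (μ ζ - μ ξ) • Z ζ + μ ξ • (Z ζ - Z ξ) := by
      rw [sub_smul, smul_sub]; abel
    have hd := norm_nonneg (ζ - ξ)
    rw [h1]
    refine (norm_add_le _ _).trans ?_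
    rw [norm_smul, norm_smul]
    have h2 : ‖μ ζ - μ ξ‖ * ‖Z ζ‖ ≤ ((ν + 54 * t) * ‖ζ - ξ‖) * (2 * r) := by
      have := hμ_sub ζ ξ hζ hξ
      have h3 : ‖Z ζ‖ ≤ 2 * r := (hZ_le ζ).trans (by linarith)
      gcongr
    have h3 : ‖μ ξ‖ * ‖Z ζ - Z ξ‖ ≤ (ν * r + 81 * t) * (2 * ‖ζ - ξ‖) := by
      have h4 : ‖μ ξ‖ ≤ ν * r + 81 * t := (hμ_le ξ hξ).trans (by gcongr)
      have := hZ_sub ζ ξ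
      gcongr
    refine (add_le_add h2 h3).trans ?_
    have h5 : 108 * t * r ≤ 54 * t := by nlinarith
    calc _ = (4 * (ν * r) + 108 * t * r + 162 * t) * ‖ζ - ξ‖ := by ring
      _ ≤ _ := mul_le_mul_of_nonneg_right (by linarith) hd
  have hF₁ : ∀ ζ ξ, ‖ζ‖ ≤ r → ‖ξ‖ ≤ r →
      ‖F₁ ζ - F₁ ξ‖ ≤ (4 * (ν * r) + 270 * t + ν * M⁻¹) * ‖ζ - ξ‖ := fun ζ ξ hζ hξ => by
    have h1 : F₁ ζ - F₁ ξ = (μ ζ • Z ζ - μ ξ • Z ξ) - V (z ζ - z ξ) -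
        (τ • N (e + Z ζ) - τ • N (e + Z ξ)) := by
      simp only [F₁, map_sub]; abel
    have h2 : ‖V (z ζ - z ξ)‖ ≤ ν * (M⁻¹ * ‖ζ - ξ‖) :=
      (hVle _).trans (mul_le_mul_of_nonneg_left (hz_sub ζ ξ) hν0.le)
    rw [h1]
    refine (norm_sub_le _ _).trans ?_
    linarith [norm_sub_le (μ ζ • Z ζ - μ ξ • Z ξ) (V (z ζ - z ξ)), hμZ_sub ζ ξ hζ hξ,
      hτN_sub ζ ξ hζ hξ]
  have hF₂ : ∀ ζ ξ, ‖ζ‖ ≤ r → ‖ξ‖ ≤ r →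
      ‖F₂ ζ - F₂ ξ‖ ≤ (4 * (ν * r) + 270 * t + 2 * ν) * ‖ζ - ξ‖ := fun ζ ξ hζ hξ => by
    have h1 : F₂ ζ - F₂ ξ = (μ ζ • Z ζ - μ ξ • Z ξ) - V (Z ζ - Z ξ) -
        (τ • N (e + Z ζ) - τ • N (e + Z ξ)) := by
      simp only [F₂, map_sub, map_add]; abel
    have h2 : ‖V (Z ζ - Z ξ)‖ ≤ ν * (2 * ‖ζ - ξ‖) :=
      (hVle _).trans (mul_le_mul_of_nonneg_left (hZ_sub ζ ξ) hν0.le)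
    rw [h1]
    refine (norm_sub_le _ _).trans ?_
    linarith [norm_sub_le (μ ζ • Z ζ - μ ξ • Z ξ) (V (Z ζ - Z ξ)), hμZ_sub ζ ξ hζ hξ,
      hτN_sub ζ ξ hζ hξ]
  have hRfle : ∀ x, ‖Rf x‖ ≤ C * ‖x‖ := Rf.le_of_opNorm_le hRf
  have hRrle : ∀ x, ‖(M : ℂ) • Rr x‖ ≤ M * g * ‖x‖ := fun x => by
    rw [norm_smul, hnM, mul_assoc]
    exact mul_le_mul_of_nonneg_left (Rr.le_of_opNorm_le hRr x) hM0.le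
  have hΦ_sub : ∀ ζ ξ, ‖ζ‖ ≤ r → ‖ξ‖ ≤ r → ‖Φ ζ - Φ ξ‖ ≤ 1 / 2 * ‖ζ - ξ‖ := fun ζ ξ hζ hξ => by
    have hd := norm_nonneg (ζ - ξ)
    rw [Prod.norm_def, max_le_iff]
    constructor
    · simp only [Φ, Prod.fst_sub, ← map_sub]
      refine (hRfle _).trans ?_
      refine (mul_le_mul_of_nonneg_left (hF₁ ζ ξ hζ hξ) hC0.le).trans ?_
      rw [← mul_assoc]
      refine mul_le_mul_of_nonneg_right ?_ hd
      have : C * (ν * M⁻¹) = 1 / 8 := by rw [hM]; field_simp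
      linarith
    · simp only [Φ, Prod.snd_sub, ← smul_sub, ← map_sub]
      refine (hRrle _).trans ?_
      refine (mul_le_mul_of_nonneg_left (hF₂ ζ ξ hζ hξ) (by positivity)).trans ?_
      rw [← mul_assoc]
      refine mul_le_mul_of_nonneg_right ?_ hd
      have h1 : 4 * (ν * r) + 270 * t + 2 * ν ≤ 3 * ν := by linarith
      have h2 := mul_le_mul_of_nonneg_left h1 (show 0 ≤ M * g by positivity)
      linarith
  have hΦ0 : ‖Φ 0‖ ≤ 54 * C * t + 24 * (C * ν ^ 2 * g) := by
    have hNe : ‖τ • N e‖ ≤ 54 * t := by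
      rw [norm_smul, ht]
      have := hNle e (by linarith)
      nlinarith
    have hpos : 0 ≤ C * ν ^ 2 * g := by positivity
    rw [Prod.norm_def, max_le_iff]
    constructor
    · have h1 : F₁ 0 = -(τ • N e) := by simp [F₁, hZ0, hz0]
      have := hRfle (-(τ • N e))
      rw [norm_neg (τ • N e)] at this
      simp only [Φ]
      rw [h1]
      refine this.trans ?_
      have := mul_le_mul_of_nonneg_left hNe hC0.le
      linarith
    · have h1 : ‖F₂ 0‖ ≤ 3 * ν := by
        have h2 : F₂ 0 = -(V e) - τ • N e := by simp [F₂, hZ0]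
        rw [h2]
        have h3 := norm_sub_le (-(V e)) (τ • N e)
        rw [norm_neg] at h3
        have h4 := (hVle e).trans (mul_le_mul_of_nonneg_left he hν0.le)
        linarith
      have h2 := (hRrle (F₂ 0)).trans (mul_le_mul_of_nonneg_left h1 (by positivity))
      simp only [Φ]
      have h3 : M * g * (3 * ν) = 24 * (C * ν ^ 2 * g) := by rw [hM]; ring
      have h4 : 0 ≤ 54 * C * t := by positivity
      linarith
  -- This inequality fixes the numerical smallness conditions: `3456/8000 + 1536/3072 < 1`.
  have hsmall : 54 * C * t + 24 * (C * ν ^ 2 * g) ≤ r / 2 := by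
    rw [hr, div_div, le_div_iff₀ (by positivity)]
    calc _ = 3456 * (C ^ 2 * ν * t) + 1536 * (C ^ 2 * ν ^ 3 * g) := by ring
      _ ≤ 1 := by linarith
  obtain ⟨ζ, hζr, hζ, hfix⟩ :=
    exists_fixedPoint_of_half_lipschitz Φ r hr0.le (hΦ0.trans hsmall) hΦ_sub
  have hζ' : ‖ζ‖ ≤ 108 * C * t + 48 * (C * ν ^ 2 * g) := by linarith
  refine ⟨ζ.1, z ζ, μ ζ, rfl, (congrArg Prod.fst hfix).symm, ?_, (hZ_le ζ).trans ?_,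
    (hμ_le ζ hζr).trans ?_⟩
  · have h1 : ζ.2 = (M : ℂ) • Rr (F₂ ζ) := (congrArg Prod.snd hfix).symm
    have hMne : (M : ℂ) ≠ 0 := by exact_mod_cast hM0.ne'
    calc z ζ = (M⁻¹ : ℂ) • ζ.2 := rfl
      _ = Rr (F₂ ζ) := by rw [h1, inv_smul_smul₀ hMne]
  · have h1 : C * t * 1 ≤ C * t * ν ^ 3 := by
      gcongr; exact one_le_pow₀ hν
    have h2 : C * g * ν ^ 2 ≤ C * g * ν ^ 3 := by
      gcongr
      norm_num
    have : 0 ≤ C * g * ν ^ 3 := by positivity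
    nlinarith
  · have h1 : C * t * ν ≤ C * t * ν ^ 3 := by
      gcongr; exact le_self_pow₀ hν (by norm_num)
    have h2 : t ≤ C * ν * t := le_mul_of_one_le_left ht0 hCν1
    have h3 : ν * ‖ζ‖ ≤ ν * (108 * C * t + 48 * (C * ν ^ 2 * g)) := by gcongr
    have : 0 ≤ C * g * ν ^ 3 := by positivity
    nlinarith

end Reduction

/-! ### The nonlinear eigenvalue problem in `ℓ¹` -/

section Eigen

open scoped Classical in
/-- The element of `ℓ¹` supported at one point. -/
def L1.single {ι : Type*} (s : ι) (x : ℂ) : L1 ι := lp.single 1 s x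

theorem L1.norm_single {ι : Type*} (s : ι) (x : ℂ) : ‖L1.single s x‖ = ‖x‖ := by
  classical exact lp.norm_single (E := fun _ : ι => ℂ) one_pos s x

@[simp]
theorem L1.single_apply_self {ι : Type*} (s : ι) (x : ℂ) : L1.single s x s = x := by
  classical exact lp.single_apply_self (E := fun _ : ι => ℂ) 1 s x

theorem L1.single_apply_ne {ι : Type*} {s p : ι} (x : ℂ) (h : p ≠ s) : L1.single s x p = 0 := by
  classical exact lp.single_apply_ne (E := fun _ : ι => ℂ) 1 s x h

theorem L1.norm_apply_add_norm_apply_le {ι : Type*} (Y : L1 ι) {m p : ι} (h : m ≠ p) :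
    ‖Y m‖ + ‖Y p‖ ≤ ‖Y‖ := by
  classical
  have := sum_le_hasSum {m, p} (fun i _ => norm_nonneg (Y i)) (L1.hasSum_norm Y)
  rwa [Finset.sum_pair h] at this

variable {ι : Type*} [AddCommGroup ι]

theorem L1.conv_single_apply (v : L1 ι) (s : ι) (x : ℂ) (p : ι) :
    L1.conv v (L1.single s x) p = v (p - s) * x := by
  rw [L1.conv_apply, tsum_eq_single (p - s)]
  · simp
  · intro m hm
    rw [L1.single_apply_ne, mul_zero]
    rintro rfl
    simp at hm

/-- Pair the equation with `Y`: the convolution term has real pairing, and each `a m` is real, so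
the imaginary parts sum to `lam.im * ∑ ‖Y m‖²`, which must vanish. Comparing imaginary parts
termwise avoids summing `a m * ‖Y m‖²`. -/
theorem im_eq_zero_of_eigenvector (a : ι → ℝ) (lam : ℂ) (W Y : L1 ι) (hW : L1.refl W = W)
    (h : ∀ m, ((a m : ℂ) - lam) * Y m + L1.conv W Y m = 0) (hY : ∃ m, Y m ≠ 0) : lam.im = 0 := by
  by_contra hne
  have hs := Complex.hasSum_im (L1.summable_pair Y (L1.conv W Y)).hasSum
  have h0 : (∑' m, (starRingEnd ℂ) (Y m) * L1.conv W Y m).im = 0 := L1.pair_conv_self_im W Y hW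
  rw [h0] at hs
  have hterm : ∀ m, ((starRingEnd ℂ) (Y m) * L1.conv W Y m).im = lam.im * ‖Y m‖ ^ 2 := fun m => by
    have h1 : L1.conv W Y m = (lam - a m) * Y m := by linear_combination h m
    have h2 : (starRingEnd ℂ) (Y m) * L1.conv W Y m = (lam - a m) * ((‖Y m‖ ^ 2 : ℝ) : ℂ) := by
      rw [h1, mul_left_comm, ← Complex.normSq_eq_conj_mul_self, Complex.normSq_eq_norm_sq]
    rw [h2, Complex.im_mul_ofReal]
    simp
  simp only [hterm] at hs
  have hs' : HasSum (fun m => ‖Y m‖ ^ 2) 0 := by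
    simpa [hne] using hs.mul_left (lam.im)⁻¹
  obtain ⟨m, hm⟩ := hY
  have := (hasSum_zero_iff_of_nonneg fun m => sq_nonneg ‖Y m‖).1 hs'
  exact hm (by simpa using congrFun this m)

/-- These are the coefficients of the real function `V + τ|f|²`. The nonlinear equation is thus a
linear one with a real potential that depends on the solution. -/
theorem refl_real_perturbation (v Y : L1 ι) (hv : L1.refl v = v) (τ : ℝ) :
    L1.refl (v + (τ : ℂ) • L1.conv Y (L1.refl Y)) = v + (τ : ℂ) • L1.conv Y (L1.refl Y) := by
  have h : L1.refl (v + (τ : ℂ) • L1.conv Y (L1.refl Y)) =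
      L1.refl v + (τ : ℂ) • L1.refl (L1.conv Y (L1.refl Y)) := L1.ext' fun p => by
    simp only [L1.refl_apply, L1.add_apply, L1.smul_apply, map_add, map_mul, Complex.conj_ofReal]
  rw [h, hv, L1.refl_conv, L1.refl_refl, L1.conv_comm]

/-- Existence of a solution of the nonlinear eigenvalue problem near the eigenvector
`e₀ δ₀ + e₁ δ_{-q}` of the `2 × 2` model. -/
theorem exists_nonlinear_eigenvector (v : L1 ι) (hv0 : v 0 = 0) (hvr : L1.refl v = v)
    (q : ι) (hq : q ≠ 0) (a : ι → ℝ) (e₀ e₁ : ℂ) (Λ τ ν C g : ℝ)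
    (h₀ : (a 0 : ℂ) * e₀ + v q * e₁ = Λ * e₀) (h₁ : v (-q) * e₀ + a (-q) * e₁ = Λ * e₁)
    (hnorm : ‖e₀‖ ^ 2 + ‖e₁‖ ^ 2 = 1) (hν : 1 ≤ ν) (hvν : ‖v‖ ≤ ν) (hC : 1 ≤ C)
    (hgap : 2 ≤ C * (2 * Λ - a 0 - a (-q))) (hg0 : 0 ≤ g)
    (hfar : ∀ m, m ≠ 0 → m ≠ -q → 1 ≤ g * |a m - Λ|)
    (hg : 3072 * (C ^ 2 * ν ^ 3 * g) ≤ 1) (hτ : 8000 * (C ^ 2 * ν * |τ|) ≤ 1) :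
    ∃ (Y : L1 ι) (lam : ℝ),
      (∀ m, ((a m : ℂ) - lam) * Y m + L1.conv v Y m + τ * L1.cubic Y m = 0) ∧
      ‖Y - (L1.single 0 e₀ + L1.single (-q) e₁)‖ ≤ 216 * C * ν ^ 3 * (g + |τ|) ∧
      |lam - Λ| ≤ 216 * C * ν ^ 3 * (g + |τ|) := by
  classical
  have hq' : (0 : ι) ≠ -q := fun h => hq (by simpa using h.symm)
  obtain ⟨d, hd⟩ : ∃ d, d = 2 * Λ - a 0 - a (-q) := ⟨_, rfl⟩
  rw [← hd] at hgap
  have hd0 : 0 < d := by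
    by_contra hcon
    nlinarith
  have hdc : (d : ℂ) ≠ 0 := by exact_mod_cast hd0.ne'
  have hn₀ : ‖e₀‖ ≤ 1 := by nlinarith [norm_nonneg e₀, sq_nonneg ‖e₁‖]
  have hn₁ : ‖e₁‖ ≤ 1 := by nlinarith [norm_nonneg e₁, sq_nonneg ‖e₀‖]
  have hnormC : (starRingEnd ℂ) e₀ * e₀ + (starRingEnd ℂ) e₁ * e₁ = 1 := by
    rw [← Complex.normSq_eq_conj_mul_self, ← Complex.normSq_eq_conj_mul_self,
      Complex.normSq_eq_norm_sq, Complex.normSq_eq_norm_sq]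
    exact_mod_cast hnorm
  let ev : ι → L1 ι →L[ℂ] ℂ := fun p => lp.evalCLM ℂ (fun _ : ι => ℂ) 1 p
  have hev : ∀ p (Y : L1 ι), ev p Y = Y p := fun _ _ => rfl
  have hfun : ∀ (x y : ℂ), ‖x‖ ≤ 1 → ‖y‖ ≤ 1 → ∀ Y : L1 ι,
      ‖(x • ev 0 + y • ev (-q)) Y‖ ≤ 1 * ‖Y‖ := fun x y hx hy Y => by
    simp only [add_apply, smul_apply, smul_eq_mul, hev]
    refine (norm_add_le _ _).trans ?_
    rw [norm_mul, norm_mul, one_mul]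
    refine le_trans ?_ (L1.norm_apply_add_norm_apply_le Y hq')
    exact add_le_add (mul_le_of_le_one_left (norm_nonneg _) hx)
      (mul_le_of_le_one_left (norm_nonneg _) hy)
  let e : L1 ι := L1.single 0 e₀ + L1.single (-q) e₁
  -- The unit vector of the block orthogonal to `e`, that is, the other model eigenvector; `φ` and
  -- `ψ` below are the coordinates along `e` and `f`.
  let f : L1 ι := L1.single 0 (-(starRingEnd ℂ) e₁) + L1.single (-q) ((starRingEnd ℂ) e₀)
  let φ : L1 ι →L[ℂ] ℂ := (starRingEnd ℂ) e₀ • ev 0 + (starRingEnd ℂ) e₁ • ev (-q)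
  let ψ : L1 ι →L[ℂ] ℂ := (-e₁) • ev 0 + e₀ • ev (-q)
  have hψ_apply : ∀ Y, ψ Y = -e₁ * Y 0 + e₀ * Y (-q) := fun _ => rfl
  have hφ_apply : ∀ Y, φ Y = (starRingEnd ℂ) e₀ * Y 0 + (starRingEnd ℂ) e₁ * Y (-q) := fun _ => rfl
  -- By the trace, the other model eigenvalue is `a 0 + a (-q) - Λ`, so the model minus `Λ` acts on
  -- `f` as `-d`.
  let Rf : L1 ι →L[ℂ] L1 ι := ψ.smulRight (-(d : ℂ)⁻¹ • f)
  have hRf_apply : ∀ Y, Rf Y = ψ Y • (-(d : ℂ)⁻¹ • f) := fun _ => rfl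
  have hfar' : ∀ m, m ≠ 0 → m ≠ -q → a m - Λ ≠ 0 := fun m h h' hz => by
    have := hfar m h h'
    rw [hz] at this
    norm_num at this
  let w : ι → ℂ := fun m => if m = 0 ∨ m = -q then 0 else ((a m - Λ : ℝ) : ℂ)⁻¹
  have hw : ∀ m, ‖w m‖ ≤ g := fun m => by
    by_cases h : m = 0 ∨ m = -q
    · simp [w, h, hg0]
    · simp only [w, if_neg h, norm_inv, Complex.norm_real, Real.norm_eq_abs]
      rw [not_or] at h
      rw [inv_le_iff_one_le_mul₀ (abs_pos.2 (hfar' m h.1 h.2))]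
      exact hfar m h.1 h.2
  have hnf : ‖f‖ ≤ 2 := by
    refine (norm_add_le _ _).trans ?_
    rw [L1.norm_single, L1.norm_single, norm_neg, RCLike.norm_conj, RCLike.norm_conj]
    linarith
  have hne : ‖e‖ ≤ 2 := by
    refine (norm_add_le _ _).trans ?_
    rw [L1.norm_single, L1.norm_single]
    linarith
  have hnRf : ‖Rf‖ ≤ C := by
    refine ContinuousLinearMap.opNorm_le_bound _ (by linarith) fun Y => ?_
    rw [hRf_apply, norm_smul, norm_smul, norm_neg, norm_inv, Complex.norm_real,
      Real.norm_of_nonneg hd0.le, mul_comm]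
    have h1 := hfun (-e₁) e₀ (by simpa using hn₁) hn₀ Y
    rw [one_mul] at h1
    have h2 : d⁻¹ * ‖f‖ ≤ C := by
      rw [inv_mul_le_iff₀ hd0]
      linarith
    exact mul_le_mul h2 h1 (norm_nonneg _) (by linarith)
  obtain ⟨z₁, z₂, μ, hμ, hz₁, hz₂, hZn, hμn⟩ := exists_reduced_solution (L1.conv v) Rf
    (L1.diag w g hw) φ L1.cubic e (τ : ℂ) ν C g hν hC hg0 ((L1.norm_conv_le v).trans hvν) hnRf
    (L1.norm_diag_le w g hg0 hw)
    (ContinuousLinearMap.opNorm_le_bound _ zero_le_one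
      (hfun _ _ (by simpa using hn₀) (by simpa using hn₁)))
    hne (fun x y hx hy => (L1.norm_cubic_sub_le hx hy).trans_eq (by norm_num)) L1.cubic_zero hg
    (by simpa using hτ)
  obtain ⟨Y, hY⟩ : ∃ Y, Y = e + (z₁ + z₂) := ⟨_, rfl⟩
  rw [← hY] at hμ hz₁ hz₂
  obtain ⟨N, hN⟩ : ∃ N, N = L1.cubic Y := ⟨_, rfl⟩
  rw [← hN] at hμ hz₁ hz₂
  have he0 : e 0 = e₀ := by simp [e, L1.single_apply_ne _ hq']
  have he1 : e (-q) = e₁ := by simp [e, L1.single_apply_ne _ hq'.symm]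
  have heo : ∀ m, m ≠ 0 → m ≠ -q → e m = 0 := fun m h h' => by
    simp [e, L1.single_apply_ne _ h, L1.single_apply_ne _ h']
  have hf0 : f 0 = -(starRingEnd ℂ) e₁ := by simp [f, L1.single_apply_ne _ hq']
  have hf1 : f (-q) = (starRingEnd ℂ) e₀ := by simp [f, L1.single_apply_ne _ hq'.symm]
  have hfo : ∀ m, m ≠ 0 → m ≠ -q → f m = 0 := fun m h h' => by
    simp [f, L1.single_apply_ne _ h, L1.single_apply_ne _ h']
  obtain ⟨c, hc⟩ : ∃ c : ℂ, c = -(d : ℂ)⁻¹ *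
    ψ (μ • (z₁ + z₂) - L1.conv v z₂ - (τ : ℂ) • N) := ⟨_, rfl⟩
  have hz₁' : ∀ m, z₁ m = c * f m := fun m => by
    rw [hz₁, hRf_apply, L1.smul_apply, L1.smul_apply, hc]
    ring
  have hz₂0 : z₂ 0 = 0 := by rw [hz₂, L1.diag_apply]; simp [w]
  have hz₂1 : z₂ (-q) = 0 := by rw [hz₂, L1.diag_apply]; simp [w]
  have hY0 : Y 0 = e₀ - c * (starRingEnd ℂ) e₁ := by
    rw [hY, L1.add_apply e, L1.add_apply z₁, he0, hz₁', hf0, hz₂0]; ring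
  have hY1 : Y (-q) = e₁ + c * (starRingEnd ℂ) e₀ := by
    rw [hY, L1.add_apply e, L1.add_apply z₁, he1, hz₁', hf1, hz₂1]; ring
  have hYo : ∀ m, m ≠ 0 → m ≠ -q → Y m = z₂ m := fun m h h' => by
    rw [hY, L1.add_apply e, L1.add_apply z₁, heo m h h', hz₁', hfo m h h']; ring
  have hYdec : Y = L1.single 0 (Y 0) + L1.single (-q) (Y (-q)) + z₂ := by
    refine L1.ext' fun m => ?_
    by_cases h : m = 0
    · subst h
      simp [L1.single_apply_ne _ hq', hz₂0]
    by_cases h' : m = -q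
    · subst h'
      simp [L1.single_apply_ne _ hq'.symm, hz₂1]
    · simp [L1.single_apply_ne _ h, L1.single_apply_ne _ h', hYo m h h']
  have hV : ∀ p, L1.conv v Y p = v p * Y 0 + v (p + q) * Y (-q) + L1.conv v z₂ p := fun p => by
    conv_lhs => rw [hYdec]
    rw [map_add, map_add, L1.add_apply, L1.add_apply, L1.conv_single_apply, L1.conv_single_apply,
      sub_zero, sub_neg_eq_add]
  -- Since `v 0 = 0`, the potential acts within the block exactly by the off-diagonal entries of the
  -- model; only `z₂` enters as a perturbation.
  have hV0 : L1.conv v Y 0 = v q * Y (-q) + L1.conv v z₂ 0 := by rw [hV, hv0, zero_add]; ring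
  have hV1 : L1.conv v Y (-q) = v (-q) * Y 0 + L1.conv v z₂ (-q) := by
    rw [hV, neg_add_cancel, hv0]; ring
  obtain ⟨p₀, hp₀⟩ : ∃ p, p = L1.conv v z₂ 0 + τ * N 0 := ⟨_, rfl⟩
  obtain ⟨p₁, hp₁⟩ : ∃ p, p = L1.conv v z₂ (-q) + τ * N (-q) := ⟨_, rfl⟩
  have hμ' : μ = (starRingEnd ℂ) e₀ * p₀ + (starRingEnd ℂ) e₁ * p₁ := by
    rw [hμ, hφ_apply]
    simp only [L1.add_apply, L1.smul_apply, hp₀, hp₁]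
  have hc' : -(d * c) = μ * c + e₁ * p₀ - e₀ * p₁ := by
    have h1 : ψ (μ • (z₁ + z₂) - L1.conv v z₂ - (τ : ℂ) • N) =
        μ * c + e₁ * p₀ - e₀ * p₁ := by
      rw [hψ_apply]
      simp only [L1.add_apply, L1.sub_apply, L1.smul_apply, hz₂0, hz₂1, hz₁', hf0, hf1, hp₀, hp₁]
      linear_combination (μ * c) * hnormC
    rw [← h1, hc]
    field_simp
  have hdΛ : (d : ℂ) = 2 * Λ - a 0 - a (-q) := by rw [hd]; push_cast; ring
  have hconj : ∀ p, (starRingEnd ℂ) (v (-p)) = v p := fun p => by rw [← L1.refl_apply, hvr]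
  have hconj' : (starRingEnd ℂ) (v q) = v (-q) := by simpa using hconj (-q)
  have h₀' : (a 0 : ℂ) * (starRingEnd ℂ) e₀ + v (-q) * (starRingEnd ℂ) e₁ =
      Λ * (starRingEnd ℂ) e₀ := by
    simpa [hconj'] using congrArg (starRingEnd ℂ) h₀
  have h₁' : v q * (starRingEnd ℂ) e₀ + a (-q) * (starRingEnd ℂ) e₁ =
      Λ * (starRingEnd ℂ) e₁ := by
    simpa [hconj] using congrArg (starRingEnd ℂ) h₁
  -- On the block, the `e` component of the equation is the formula for `μ` and the `f` component is
  -- `hc'`; `hnormC` recombines them into the coordinates `0` and `-q`. Off the block it is the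
  -- equation for `z₂`.
  have heq : ∀ m, ((a m : ℂ) - (Λ + μ)) * Y m + L1.conv v Y m + τ * N m = 0 := fun m => by
    by_cases h : m = 0
    · subst h
      rw [hV0, hY0, hY1, hμ']
      rw [hμ', hdΛ] at hc'
      linear_combination h₀ + c * h₁' - (starRingEnd ℂ) e₁ * hc' - hp₀ - p₀ * hnormC
    by_cases h' : m = -q
    · subst h'
      rw [hV1, hY0, hY1, hμ']
      rw [hμ', hdΛ] at hc'
      linear_combination h₁ - c * h₀' + (starRingEnd ℂ) e₀ * hc' - hp₁ - p₁ * hnormC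
    · have h1 : z₂ m = ((a m - Λ : ℝ) : ℂ)⁻¹ *
          (μ * Y m - L1.conv v Y m - τ * N m) := by
        conv_lhs => rw [hz₂, L1.diag_apply]
        have h3 : (z₁ + z₂) m = Y m := by rw [hY, L1.add_apply e, heo m h h', zero_add]
        simp only [L1.sub_apply, L1.smul_apply, h3]
        simp [w, h, h']
      have h2 : ((a m - Λ : ℝ) : ℂ) ≠ 0 := by exact_mod_cast hfar' m h h'
      rw [← hYo m h h', eq_inv_mul_iff_mul_eq₀ h2] at h1
      push_cast at h1
      linear_combination h1
  -- The correction has no component along `e`, so `Y` cannot vanish, as the reality argument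
  -- requires.
  have hφY : (starRingEnd ℂ) e₀ * Y 0 + (starRingEnd ℂ) e₁ * Y (-q) = 1 := by
    rw [hY0, hY1]
    linear_combination hnormC
  have hYne : ∃ m, Y m ≠ 0 := by
    by_contra! hcon
    rw [hcon, hcon] at hφY
    simp at hφY
  have him : μ.im = 0 := by
    have := im_eq_zero_of_eigenvector a (Λ + μ) (v + (τ : ℂ) • L1.conv Y (L1.refl Y)) Y
      (refl_real_perturbation v Y hvr τ) (fun m => by
        rw [L1.conv_add_left, L1.conv_smul_left, L1.add_apply, L1.smul_apply, ← add_assoc,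
          ← heq m, hN]
        rfl) hYne
    simpa using this
  have hμre : μ = (μ.re : ℂ) := Complex.ext rfl (by simpa using him)
  refine ⟨Y, Λ + μ.re, fun m => ?_, ?_, ?_⟩
  · have := heq m
    rw [hμre, hN] at this
    push_cast
    exact this
  · have h1 : Y - e = z₁ + z₂ := by rw [hY]; abel
    change ‖Y - e‖ ≤ _
    rw [h1]
    simpa using hZn
  · rw [add_sub_cancel_left]
    refine (Complex.abs_re_le_norm μ).trans ?_
    simpa using hμn

end Eigen

/-! ### Series of plane waves -/

section PlaneWave

variable {n : ℕ}

theorem norm_planeWave (p x : EuclideanSpace ℝ (Fin n)) : ‖planeWave p x‖ = 1 := by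
  rw [planeWave, mul_comm, Complex.norm_exp_ofReal_mul_I]

theorem planeWave_add (p p' x : EuclideanSpace ℝ (Fin n)) :
    planeWave (p + p') x = planeWave p x * planeWave p' x := by
  rw [planeWave, planeWave, planeWave, ← Complex.exp_add, inner_add_left]
  push_cast
  ring_nf

theorem planeWave_add_right (p x y : EuclideanSpace ℝ (Fin n)) :
    planeWave p (x + y) = planeWave p x * planeWave p y := by
  rw [planeWave, planeWave, planeWave, ← Complex.exp_add, inner_add_right]
  push_cast
  ring_nf

@[simp]
theorem planeWave_zero (x : EuclideanSpace ℝ (Fin n)) : planeWave 0 x = 1 := by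
  simp [planeWave]

theorem conj_planeWave (p x : EuclideanSpace ℝ (Fin n)) :
    (starRingEnd ℂ) (planeWave p x) = planeWave (-p) x := by
  rw [planeWave, planeWave, ← Complex.exp_conj]
  simp [inner_neg_left]

theorem latticePoint_add (m p : Fin n → ℤ) :
    latticePoint (m + p) = latticePoint m + latticePoint p := by
  ext i
  simp [latticePoint]

theorem latticePoint_neg (m : Fin n → ℤ) : latticePoint (-m) = -latticePoint m := by
  ext i
  simp [latticePoint]

@[simp]
theorem latticePoint_zero : latticePoint (0 : Fin n → ℤ) = 0 := by
  ext i
  simp [latticePoint]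

theorem latticePoint_sub (m p : Fin n → ℤ) :
    latticePoint (m - p) = latticePoint m - latticePoint p := by
  rw [sub_eq_add_neg, latticePoint_add, latticePoint_neg, sub_eq_add_neg]

theorem planeWave_single (p : EuclideanSpace ℝ (Fin n)) (s : Fin n) (r : ℝ) :
    planeWave p (EuclideanSpace.single s r) = Complex.exp (Complex.I * (r * p s : ℝ)) := by
  simp [planeWave, EuclideanSpace.inner_single_right]

theorem planeWave_latticePoint_period (m : Fin n → ℤ) (s : Fin n) :
    planeWave (latticePoint m) (EuclideanSpace.single s (2 * Real.pi)) = 1 := by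
  rw [planeWave_single, Complex.exp_eq_one_iff]
  refine ⟨m s, ?_⟩
  simp only [latticePoint]
  push_cast
  ring

theorem iteratedDeriv_exp_I_mul (k : ℕ) :
    iteratedDeriv k (fun s : ℝ => Complex.exp (Complex.I * s)) =
      fun s : ℝ => Complex.I ^ k * Complex.exp (Complex.I * s) := by
  induction k with
  | zero => simp
  | succ k ih =>
    rw [iteratedDeriv_succ, ih]
    funext s
    have h : HasDerivAt (fun s : ℝ => Complex.exp (Complex.I * s))
        (Complex.exp (Complex.I * s) * (Complex.I * 1)) s :=
      ((Complex.ofRealCLM.hasDerivAt (x := s)).const_mul Complex.I).cexp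
    rw [(h.const_mul (Complex.I ^ k)).deriv]
    ring

theorem contDiff_exp_I_mul {N : WithTop ℕ∞} :
    ContDiff ℝ N (fun s : ℝ => Complex.exp (Complex.I * s)) :=
  (contDiff_const.mul Complex.ofRealCLM.contDiff).cexp

theorem contDiff_planeWave {N : WithTop ℕ∞} (p : EuclideanSpace ℝ (Fin n)) :
    ContDiff ℝ N (planeWave p) :=
  contDiff_exp_I_mul.comp (innerSL ℝ p).contDiff

theorem iteratedFDeriv_planeWave_apply (p x : EuclideanSpace ℝ (Fin n)) (k : ℕ)
    (y : Fin k → EuclideanSpace ℝ (Fin n)) :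
    iteratedFDeriv ℝ k (planeWave p) x y =
      (∏ i, ((inner ℝ p (y i) : ℝ) : ℂ)) * (Complex.I ^ k * planeWave p x) := by
  have h : planeWave p = (fun s : ℝ => Complex.exp (Complex.I * s)) ∘ (innerSL ℝ p) := rfl
  rw [h, (innerSL ℝ p).iteratedFDeriv_comp_right (contDiff_exp_I_mul (N := k)) x le_rfl,
    ContinuousMultilinearMap.compContinuousLinearMap_apply,
    iteratedFDeriv_apply_eq_iteratedDeriv_mul_prod, iteratedDeriv_exp_I_mul]
  simp

theorem norm_iteratedFDeriv_planeWave_le (p x : EuclideanSpace ℝ (Fin n)) (k : ℕ) :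
    ‖iteratedFDeriv ℝ k (planeWave p) x‖ ≤ ‖p‖ ^ k := by
  refine ContinuousMultilinearMap.opNorm_le_bound (by positivity) fun y => ?_
  rw [iteratedFDeriv_planeWave_apply]
  simp only [norm_mul, norm_pow, Complex.norm_I, one_pow, norm_planeWave, mul_one, norm_prod,
    Complex.norm_real]
  calc ∏ i, ‖inner ℝ p (y i)‖ ≤ ∏ i, (‖p‖ * ‖y i‖) :=
        Finset.prod_le_prod (fun _ _ => norm_nonneg _) fun i _ => norm_inner_le_norm _ _
    _ = _ := by rw [Finset.prod_mul_distrib]; simp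

variable {α : Type*}

/-- The function `∑ c_m e^{i⟨p_m, x⟩}`. -/
def waveSeries (c : α → ℂ) (p : α → EuclideanSpace ℝ (Fin n)) (x : EuclideanSpace ℝ (Fin n)) : ℂ :=
  ∑' m, c m * planeWave (p m) x

theorem iteratedFDeriv_wave (c : ℂ) (p x : EuclideanSpace ℝ (Fin n)) (k : ℕ) :
    iteratedFDeriv ℝ k (fun x => c * planeWave p x) x = c • iteratedFDeriv ℝ k (planeWave p) x :=
  iteratedFDeriv_const_smul_apply' (a := c) (contDiff_planeWave p).contDiffAt

theorem norm_iteratedFDeriv_wave_le (c : ℂ) (p x : EuclideanSpace ℝ (Fin n)) (k : ℕ) :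
    ‖iteratedFDeriv ℝ k (fun x => c * planeWave p x) x‖ ≤ ‖c‖ * ‖p‖ ^ k := by
  rw [iteratedFDeriv_wave, norm_smul]
  exact mul_le_mul_of_nonneg_left (norm_iteratedFDeriv_planeWave_le p x k) (norm_nonneg _)

/-- Interpolation by `s ^ k ≤ 1 + s ^ N` for `s ≥ 0`. -/
theorem summable_mul_pow_of_le {c : α → ℂ} {p : α → EuclideanSpace ℝ (Fin n)} {N k : ℕ}
    (h0 : Summable fun m => ‖c m‖) (hN : Summable fun m => ‖c m‖ * ‖p m‖ ^ N) (hk : k ≤ N) :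
    Summable fun m => ‖c m‖ * ‖p m‖ ^ k := by
  refine Summable.of_nonneg_of_le (fun m => by positivity) (fun m => ?_) (h0.add hN)
  rcases le_total ‖p m‖ 1 with h | h
  · have h1 : ‖p m‖ ^ k ≤ 1 := pow_le_one₀ (norm_nonneg _) h
    have h2 : 0 ≤ ‖c m‖ * ‖p m‖ ^ N := by positivity
    have h3 := mul_le_mul_of_nonneg_left h1 (norm_nonneg (c m))
    linarith
  · have h3 := mul_le_mul_of_nonneg_left (pow_le_pow_right₀ h hk) (norm_nonneg (c m))
    have h4 := norm_nonneg (c m)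
    linarith

theorem contDiff_waveSeries {c : α → ℂ} {p : α → EuclideanSpace ℝ (Fin n)} {N : ℕ}
    (h0 : Summable fun m => ‖c m‖) (hN : Summable fun m => ‖c m‖ * ‖p m‖ ^ N) :
    ContDiff ℝ N (waveSeries c p) :=
  contDiff_tsum (N := (N : ℕ∞)) (v := fun k m => ‖c m‖ * ‖p m‖ ^ k)
    (fun m => contDiff_const.mul (contDiff_planeWave (p m)))
    (fun _ hk => summable_mul_pow_of_le h0 hN (by exact_mod_cast hk))
    (fun k m x _ => norm_iteratedFDeriv_wave_le (c m) (p m) x k)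

theorem continuous_waveSeries {c : α → ℂ} {p : α → EuclideanSpace ℝ (Fin n)}
    (h0 : Summable fun m => ‖c m‖) : Continuous (waveSeries c p) :=
  (contDiff_waveSeries (N := 0) h0 (by simpa using h0)).continuous

theorem laplacian_wave (c : ℂ) (p x : EuclideanSpace ℝ (Fin n)) :
    ∑ i, iteratedFDeriv ℝ 2 (fun x => c * planeWave p x) x
      ![EuclideanSpace.basisFun (Fin n) ℝ i, EuclideanSpace.basisFun (Fin n) ℝ i] =
      -((c * (‖p‖ ^ 2 : ℝ)) * planeWave p x) := by
  have hp : ((‖p‖ ^ 2 : ℝ) : ℂ) = ∑ i, (p i : ℂ) * p i := by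
    rw [EuclideanSpace.real_norm_sq_eq]
    push_cast
    simp only [sq]
  rw [iteratedFDeriv_wave, hp, Finset.mul_sum, Finset.sum_mul, ← Finset.sum_neg_distrib]
  refine Finset.sum_congr rfl fun i _ => ?_
  rw [smul_apply, iteratedFDeriv_planeWave_apply]
  simp [Fin.prod_univ_two, EuclideanSpace.inner_single_right]
  ring

theorem neg_laplacian_waveSeries {c : α → ℂ} {p : α → EuclideanSpace ℝ (Fin n)}
    (h0 : Summable fun m => ‖c m‖) (h2 : Summable fun m => ‖c m‖ * ‖p m‖ ^ 2) :
    -Laplacian.laplacian (waveSeries c p) = waveSeries (fun m => c m * (‖p m‖ ^ 2 : ℝ)) p := by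
  funext x
  have hsum : ∀ k : ℕ, k ≤ 2 → Summable fun m => ‖c m‖ * ‖p m‖ ^ k := fun k hk =>
    summable_mul_pow_of_le h0 h2 hk
  have hd : iteratedFDeriv ℝ 2 (waveSeries c p) x =
      ∑' m, iteratedFDeriv ℝ 2 (fun x => c m * planeWave (p m) x) x :=
    iteratedFDeriv_tsum_apply (N := (2 : ℕ)) (v := fun k m => ‖c m‖ * ‖p m‖ ^ k)
      (fun m => contDiff_const.mul (contDiff_planeWave (p m)))
      (fun k hk => hsum k (by exact_mod_cast hk))
      (fun k m x _ => norm_iteratedFDeriv_wave_le (c m) (p m) x k) le_rfl x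
  have hs : Summable fun m => iteratedFDeriv ℝ 2 (fun x => c m * planeWave (p m) x) x :=
    Summable.of_norm_bounded h2 fun m => norm_iteratedFDeriv_wave_le (c m) (p m) x 2
  have hap : ∀ y, HasSum (fun m => iteratedFDeriv ℝ 2 (fun x => c m * planeWave (p m) x) x y)
      (iteratedFDeriv ℝ 2 (waveSeries c p) x y) := fun y => by
    rw [hd]
    exact hs.hasSum.mapL (ContinuousMultilinearMap.apply ℝ _ _ y)
  rw [Pi.neg_apply, InnerProductSpace.laplacian_eq_iteratedFDeriv_orthonormalBasis _
    (EuclideanSpace.basisFun (Fin n) ℝ)]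
  have hfin := hasSum_sum (s := Finset.univ) fun i _ => hap
    ![EuclideanSpace.basisFun (Fin n) ℝ i, EuclideanSpace.basisFun (Fin n) ℝ i]
  simp only [laplacian_wave] at hfin
  beta_reduce
  rw [← hfin.tsum_eq, tsum_neg, neg_neg]
  rfl

theorem polyLaplacian_waveSeries {c : α → ℂ} {p : α → EuclideanSpace ℝ (Fin n)} {N : ℕ} (l : ℕ)
    (hl : 2 * l ≤ N) (h0 : Summable fun m => ‖c m‖) (hN : Summable fun m => ‖c m‖ * ‖p m‖ ^ N) :
    polyLaplacian l (waveSeries c p) = waveSeries (fun m => c m * (‖p m‖ ^ (2 * l) : ℝ)) p := by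
  induction l with
  | zero => simp [polyLaplacian]
  | succ l ih =>
    have ih := ih (by omega)
    rw [polyLaplacian] at ih ⊢
    have hnorm : ∀ m, ‖c m * (‖p m‖ ^ (2 * l) : ℝ)‖ = ‖c m‖ * ‖p m‖ ^ (2 * l) := fun m => by
      rw [norm_mul, Complex.norm_real, Real.norm_of_nonneg (by positivity)]
    rw [Function.iterate_succ_apply', ih, neg_laplacian_waveSeries]
    · congr 1
      funext m
      push_cast
      ring
    · simp only [hnorm]
      exact summable_mul_pow_of_le h0 hN (by omega)
    · simp only [hnorm, mul_assoc, ← pow_add]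
      exact summable_mul_pow_of_le h0 hN (by omega)

end PlaneWave

/-! ### Fourier coefficients -/

section Fourier

open MeasureTheory

variable {n : ℕ}

/-- The cube `[0, 2π]ⁿ`. -/
def periodCube (n : ℕ) : Set (EuclideanSpace ℝ (Fin n)) :=
  {x | ∀ i, x i ∈ Set.Icc 0 (2 * Real.pi)}

theorem toLp_preimage_periodCube :
    (WithLp.toLp 2 : (Fin n → ℝ) → EuclideanSpace ℝ (Fin n)) ⁻¹' periodCube n =
      Set.univ.pi fun _ => Set.Icc 0 (2 * Real.pi) := by
  ext x
  simp only [Set.mem_preimage, Set.mem_univ_pi]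
  rfl

theorem measurableEmbedding_toLp :
    MeasurableEmbedding (WithLp.toLp 2 : (Fin n → ℝ) → EuclideanSpace ℝ (Fin n)) :=
  (MeasurableEquiv.toLp 2 (Fin n → ℝ)).measurableEmbedding

theorem setIntegral_periodCube (f : EuclideanSpace ℝ (Fin n) → ℂ) :
    ∫ x in periodCube n, f x = ∫ x, f (WithLp.toLp 2 x)
      ∂(Measure.pi fun _ : Fin n => (volume : Measure ℝ).restrict (Set.Icc 0 (2 * Real.pi))) := by
  rw [← (PiLp.volume_preserving_toLp (Fin n)).setIntegral_preimage_emb measurableEmbedding_toLp,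
    toLp_preimage_periodCube, volume_pi, Measure.restrict_pi_pi]

theorem volume_periodCube_lt_top : volume (periodCube n) < ∞ := by
  rw [← (PiLp.volume_preserving_toLp (Fin n)).measure_preimage_emb measurableEmbedding_toLp,
    toLp_preimage_periodCube]
  exact (isCompact_univ_pi fun _ => isCompact_Icc).measure_lt_top

theorem setIntegral_exp_int_mul (b : ℤ) :
    ∫ s in Set.Icc 0 (2 * Real.pi), Complex.exp (Complex.I * ((b * s : ℝ) : ℂ)) =
      if b = 0 then ((2 * Real.pi : ℝ) : ℂ) else 0 := by
  rw [integral_Icc_eq_integral_Ioc, ← intervalIntegral.integral_of_le Real.two_pi_pos.le]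
  split_ifs with hb
  · simp [hb]
  · have hc : Complex.I * (b : ℂ) ≠ 0 := mul_ne_zero Complex.I_ne_zero (by exact_mod_cast hb)
    have h := integral_exp_mul_complex (a := 0) (b := 2 * Real.pi) hc
    have h1 : Complex.exp (Complex.I * b * ((2 * Real.pi : ℝ) : ℂ)) = 1 := by
      rw [Complex.exp_eq_one_iff]
      exact ⟨b, by push_cast; ring⟩
    rw [h1] at h
    simp only [Complex.ofReal_zero, mul_zero, Complex.exp_zero, sub_self, zero_div] at h
    rw [← h]
    refine intervalIntegral.integral_congr fun s _ => ?_
    simp [mul_assoc]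

theorem setIntegral_planeWave (b : Fin n → ℤ) :
    ∫ x in periodCube n, planeWave (latticePoint b) x =
      if b = 0 then (((2 * Real.pi) ^ n : ℝ) : ℂ) else 0 := by
  rw [setIntegral_periodCube]
  have h : ∀ x : Fin n → ℝ, planeWave (latticePoint b) (WithLp.toLp 2 x) =
      ∏ i, Complex.exp (Complex.I * ((b i * x i : ℝ) : ℂ)) := fun x => by
    rw [← Complex.exp_sum, planeWave, ← Finset.mul_sum, ← Complex.ofReal_sum]
    congr 3
    simp [latticePoint, PiLp.inner_apply, mul_comm]
  simp only [h]
  rw [integral_fintype_prod_eq_prod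
    (f := fun (i : Fin n) (s : ℝ) => Complex.exp (Complex.I * ((b i * s : ℝ) : ℂ)))]
  simp only [setIntegral_exp_int_mul]
  split_ifs with hb
  · simp [hb]
  · obtain ⟨i, hi⟩ := Function.ne_iff.1 hb
    exact Finset.prod_eq_zero (Finset.mem_univ i) (if_neg hi)

/-- Absolute summability permits termwise integration over the cube, and orthogonality of the
exponentials leaves one term. -/
theorem fourierCoefficient_waveSeries (c : L1 (Fin n → ℤ)) (b : Fin n → ℤ) :
    fourierCoefficient (waveSeries c latticePoint) b = c b := by
  have hfin : IsFiniteMeasure (volume.restrict (periodCube n)) :=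
    ⟨by rw [Measure.restrict_apply_univ]; exact volume_periodCube_lt_top⟩
  let F : (Fin n → ℤ) → EuclideanSpace ℝ (Fin n) → ℂ := fun m x =>
    c m * planeWave (latticePoint (m - b)) x
  have hF : ∀ x, waveSeries c latticePoint x * planeWave (-latticePoint b) x = ∑' m, F m x :=
      fun x => by
    rw [waveSeries, ← tsum_mul_right]
    refine tsum_congr fun m => ?_
    rw [mul_assoc, ← planeWave_add, ← sub_eq_add_neg, ← latticePoint_sub]
  have hnF : ∀ m x, ‖F m x‖ = ‖c m‖ := fun m x => by
    rw [norm_mul, norm_planeWave, mul_one]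
  have hF_int : ∀ m, Integrable (F m) (volume.restrict (periodCube n)) := fun m => by
    refine Integrable.of_bound (C := ‖c m‖) ?_ (Filter.Eventually.of_forall fun x => (hnF m x).le)
    exact (continuous_const.mul (contDiff_planeWave (N := 0) _).continuous).aestronglyMeasurable
  have hsum : Summable fun m => ∫ x in periodCube n, ‖F m x‖ := by
    simp only [hnF, integral_const, smul_eq_mul]
    exact (L1.summable_norm c).mul_left _
  have h := hasSum_integral_of_summable_integral_norm hF_int hsum
  have hval : ∀ m, ∫ x in periodCube n, F m x =
      if m = b then c m * (((2 * Real.pi) ^ n : ℝ) : ℂ) else 0 := fun m => by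
    simp only [F]
    rw [integral_const_mul, setIntegral_planeWave]
    simp only [sub_eq_zero, mul_ite, mul_zero]
  have hs : ∫ x in periodCube n, ∑' m, F m x = c b * (((2 * Real.pi) ^ n : ℝ) : ℂ) := by
    rw [← h.tsum_eq]
    simp only [hval, tsum_ite_eq]
  have hpi : (((2 * Real.pi) ^ n : ℝ) : ℂ) ≠ 0 := by
    exact_mod_cast (pow_pos Real.two_pi_pos n).ne'
  rw [fourierCoefficient]
  simp only [hF]
  change _ * ∫ x in periodCube n, ∑' m, F m x = _
  rw [hs]
  field_simp

theorem starNorm_waveSeries (c : L1 (Fin n → ℤ)) :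
    starNorm (waveSeries c latticePoint) = ENNReal.ofReal ‖c‖ := by
  rw [starNorm, L1.norm_eq, ENNReal.ofReal_tsum_of_nonneg (fun _ => norm_nonneg _)
    (L1.summable_norm c)]
  simp only [fourierCoefficient_waveSeries, ofReal_norm]

/-! ### Functions with absolutely summable Fourier coefficients -/

theorem hasSum_waveSeries (c : L1 (Fin n → ℤ)) (p : (Fin n → ℤ) → EuclideanSpace ℝ (Fin n))
    (x : EuclideanSpace ℝ (Fin n)) :
    HasSum (fun m => c m * planeWave (p m) x) (waveSeries c p x) :=
  (Summable.of_norm (by simpa [norm_planeWave] using L1.summable_norm c)).hasSum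

theorem waveSeries_add (c c' : L1 (Fin n → ℤ)) (p : (Fin n → ℤ) → EuclideanSpace ℝ (Fin n))
    (x : EuclideanSpace ℝ (Fin n)) :
    waveSeries (c + c' : L1 (Fin n → ℤ)) p x = waveSeries c p x + waveSeries c' p x := by
  rw [← ((hasSum_waveSeries c p x).add (hasSum_waveSeries c' p x)).tsum_eq, waveSeries]
  simp only [L1.add_apply, add_mul]

theorem waveSeries_smul (a : ℂ) (c : L1 (Fin n → ℤ))
    (p : (Fin n → ℤ) → EuclideanSpace ℝ (Fin n)) (x : EuclideanSpace ℝ (Fin n)) :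
    waveSeries (a • c : L1 (Fin n → ℤ)) p x = a * waveSeries c p x := by
  rw [← ((hasSum_waveSeries c p x).mul_left a).tsum_eq, waveSeries]
  simp only [L1.smul_apply, mul_assoc]

theorem waveSeries_single (s : Fin n → ℤ) (a : ℂ) (p : (Fin n → ℤ) → EuclideanSpace ℝ (Fin n))
    (x : EuclideanSpace ℝ (Fin n)) :
    waveSeries (L1.single s a) p x = a * planeWave (p s) x := by
  rw [waveSeries, tsum_eq_single s, L1.single_apply_self]
  intro m hm
  rw [L1.single_apply_ne _ hm, zero_mul]

/-- The value at `x` of the function with Fourier coefficients `c`, as a functional of `c`. -/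
def evalFourier (x : EuclideanSpace ℝ (Fin n)) : L1 (Fin n → ℤ) →L[ℂ] ℂ :=
  LinearMap.mkContinuous
    { toFun := fun c => waveSeries c latticePoint x
      map_add' := fun c c' => waveSeries_add c c' _ x
      map_smul' := fun a c => waveSeries_smul a c _ x } 1 (fun c => by
    rw [one_mul, L1.norm_eq]
    refine (norm_tsum_le_tsum_norm ?_).trans_eq ?_
    · simpa [norm_planeWave] using L1.summable_norm c
    · simp [norm_planeWave])

theorem waveSeries_shift (m : Fin n → ℤ) (c : L1 (Fin n → ℤ)) (x : EuclideanSpace ℝ (Fin n)) :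
    waveSeries (L1.shift m c) latticePoint x =
      planeWave (latticePoint m) x * waveSeries c latticePoint x := by
  rw [waveSeries, waveSeries, ← tsum_mul_left, ← (Equiv.addRight m).tsum_eq]
  refine tsum_congr fun p => ?_
  simp only [Equiv.coe_addRight, L1.shift_apply, add_sub_cancel_right, latticePoint_add,
    planeWave_add]
  ring

/-- Evaluation at `x` is a continuous functional on `ℓ¹` that turns a shift into multiplication by a
plane wave; apply it to the series defining the convolution. -/
theorem waveSeries_conv (c c' : L1 (Fin n → ℤ)) (x : EuclideanSpace ℝ (Fin n)) :
    waveSeries (L1.conv c c') latticePoint x =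
      waveSeries c latticePoint x * waveSeries c' latticePoint x := by
  have h := (L1.hasSum_conv c c').mapL (evalFourier x)
  have h' : ∀ m, evalFourier x (c m • L1.shift m c') =
      c m * planeWave (latticePoint m) x * waveSeries c' latticePoint x := fun m => by
    rw [map_smul, smul_eq_mul, mul_assoc, ← waveSeries_shift]
    rfl
  simp only [h'] at h
  exact h.unique ((hasSum_waveSeries c latticePoint x).mul_right _)

theorem waveSeries_refl (c : L1 (Fin n → ℤ)) (x : EuclideanSpace ℝ (Fin n)) :
    waveSeries (L1.refl c) latticePoint x = (starRingEnd ℂ) (waveSeries c latticePoint x) := by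
  rw [waveSeries, waveSeries, Complex.conj_tsum, ← (Equiv.neg (Fin n → ℤ)).tsum_eq]
  refine tsum_congr fun m => ?_
  simp [conj_planeWave, latticePoint_neg]

theorem waveSeries_cubic (c : L1 (Fin n → ℤ)) (x : EuclideanSpace ℝ (Fin n)) :
    waveSeries (L1.cubic c) latticePoint x =
      ((‖waveSeries c latticePoint x‖ ^ 2 : ℝ) : ℂ) * waveSeries c latticePoint x := by
  rw [L1.cubic, waveSeries_conv, waveSeries_conv, waveSeries_refl, Complex.mul_conj,
    Complex.normSq_eq_norm_sq]

theorem isPeriodic_waveSeries (c : L1 (Fin n → ℤ)) : IsPeriodic (waveSeries c latticePoint) := by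
  intro s x
  refine tsum_congr fun m => ?_
  rw [planeWave_add_right, planeWave_latticePoint_period, mul_one]

theorem isQuasiPeriodic_of_forall {l : ℕ} {t : EuclideanSpace ℝ (Fin n)}
    {u : EuclideanSpace ℝ (Fin n) → ℂ} (hu : ContDiff ℝ (2 * l : ℕ) u)
    (h : ∀ s x, u (x + EuclideanSpace.single s (2 * Real.pi)) =
      Complex.exp (2 * Real.pi * Complex.I * (t s : ℂ)) * u x) :
    IsQuasiPeriodic l t u := by
  intro s m hm x
  have hu' : ContDiff ℝ m u := hu.of_le (by exact_mod_cast hm.le)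
  rw [← iteratedFDeriv_comp_add_right]
  have h1 : (fun z => u (z + EuclideanSpace.single s (2 * Real.pi))) =
      fun z => Complex.exp (2 * Real.pi * Complex.I * (t s : ℂ)) • u z := funext (h s)
  rw [h1, iteratedFDeriv_const_smul_apply' hu'.contDiffAt]
  rfl

end Fourier

/-! ### Solutions from eigenvectors in `ℓ¹` -/

section Solution

variable {n : ℕ}

/-- The Fourier coefficients of a trigonometric polynomial, as an element of `ℓ¹`. -/
def coeffL1 (v : (Fin n → ℤ) →₀ ℂ) : L1 (Fin n → ℤ) :=
  L1.mk v (summable_of_ne_finset_zero (s := v.support) fun m hm => by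
    rw [Finsupp.notMem_support_iff.1 hm, norm_zero])

@[simp]
theorem coeffL1_apply (v : (Fin n → ℤ) →₀ ℂ) (m : Fin n → ℤ) : coeffL1 v m = v m := rfl

theorem waveSeries_coeffL1 (v : (Fin n → ℤ) →₀ ℂ) (x : EuclideanSpace ℝ (Fin n)) :
    waveSeries (coeffL1 v) latticePoint x = potential v x := by
  rw [waveSeries, potential, Finsupp.sum]
  refine tsum_eq_sum fun m hm => ?_
  rw [coeffL1_apply, Finsupp.notMem_support_iff.1 hm, zero_mul]

theorem shiftedPoint_add (j m : Fin n → ℤ) (t : EuclideanSpace ℝ (Fin n)) :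
    shiftedPoint (j + m) t = shiftedPoint j t + latticePoint m := by
  rw [shiftedPoint, shiftedPoint, latticePoint_add]
  abel

theorem planeWave_shiftedPoint_period (j : Fin n → ℤ) (t : EuclideanSpace ℝ (Fin n)) (s : Fin n) :
    planeWave (shiftedPoint j t) (EuclideanSpace.single s (2 * Real.pi)) =
      Complex.exp (2 * Real.pi * Complex.I * (t s : ℂ)) := by
  rw [shiftedPoint, planeWave_add, planeWave_latticePoint_period, one_mul, planeWave_single]
  push_cast
  ring_nf

/-- A solution in `ℓ¹` of the nonlinear eigenvalue problem gives a classical quasi-periodic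
solution of the differential equation. -/
theorem isSolution_of_eigenvector (l : ℕ) (v : (Fin n → ℤ) →₀ ℂ) (j : Fin n → ℤ)
    (t : EuclideanSpace ℝ (Fin n)) (Y : L1 (Fin n → ℤ)) (lam σ : ℝ) (B : ℂ)
    (hY : ∀ m, ((freeEigenvalue l (j + m) t : ℂ) - lam) * Y m + L1.conv (coeffL1 v) Y m +
      (σ * ‖B‖ ^ 2 : ℝ) * L1.cubic Y m = 0) :
    let u := fun x => B * planeWave (shiftedPoint j t) x * waveSeries Y latticePoint x
    IsSolution l (potential v) σ lam u ∧ IsQuasiPeriodic l t u := by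
  intro u
  let p : (Fin n → ℤ) → EuclideanSpace ℝ (Fin n) := fun m => shiftedPoint (j + m) t
  have hwave : ∀ (c : L1 (Fin n → ℤ)) x,
      planeWave (shiftedPoint j t) x * waveSeries c latticePoint x = waveSeries c p x :=
      fun c x => by
    rw [waveSeries, waveSeries, ← tsum_mul_left]
    refine tsum_congr fun m => ?_
    simp only [p]
    rw [shiftedPoint_add, planeWave_add]
    ring
  have hu : u = waveSeries (B • Y : L1 (Fin n → ℤ)) p := by
    funext x
    rw [waveSeries_smul, ← hwave]
    simp only [u]
    ring
  -- The equation expresses `a_m Y_m` through elements of `ℓ¹`. Hence `|P_{j+m}(t)|^{2l} Y_m` is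
  -- summable, which gives the `C^{2l}` regularity without further bootstrapping.
  let W : L1 (Fin n → ℤ) := (lam : ℂ) • Y + (-1 : ℂ) • L1.conv (coeffL1 v) Y +
    (-(σ * ‖B‖ ^ 2 : ℝ) : ℂ) • L1.cubic Y
  have hW : ∀ m, (freeEigenvalue l (j + m) t : ℂ) * Y m = W m := fun m => by
    simp only [W, L1.add_apply, L1.smul_apply]
    linear_combination hY m
  have h0 : Summable fun m => ‖(B • Y : L1 (Fin n → ℤ)) m‖ := L1.summable_norm _
  have hpow : ∀ m, ‖p m‖ ^ (2 * l) = freeEigenvalue l (j + m) t := fun m => rfl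
  have hfree : ∀ m, 0 ≤ freeEigenvalue l (j + m) t := fun m => by
    rw [← hpow]; positivity
  have hN : Summable fun m => ‖(B • Y : L1 (Fin n → ℤ)) m‖ * ‖p m‖ ^ (2 * l) := by
    have h := L1.summable_norm (B • W)
    refine h.congr fun m => ?_
    rw [hpow, L1.smul_apply, L1.smul_apply, ← hW, norm_mul, norm_mul, norm_mul, Complex.norm_real,
      Real.norm_of_nonneg (hfree m)]
    ring
  have hsmooth : ContDiff ℝ (2 * l : ℕ) u := by
    rw [hu]
    exact contDiff_waveSeries h0 hN
  refine ⟨⟨hsmooth, fun x => ?_⟩, isQuasiPeriodic_of_forall hsmooth fun s x => ?_⟩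
  · have h1 : polyLaplacian l u x =
        B * (planeWave (shiftedPoint j t) x * waveSeries W latticePoint x) := by
      rw [hu, polyLaplacian_waveSeries l le_rfl h0 hN, hwave, ← waveSeries_smul]
      refine tsum_congr fun m => ?_
      beta_reduce
      rw [hpow, L1.smul_apply, L1.smul_apply, ← hW]
      ring
    have h2 : ‖u x‖ ^ 2 = ‖B‖ ^ 2 * ‖waveSeries Y latticePoint x‖ ^ 2 := by
      simp only [u]
      rw [norm_mul, norm_mul, norm_planeWave]
      ring
    rw [h1, h2]
    simp only [W, u]
    rw [waveSeries_add, waveSeries_add, waveSeries_smul, waveSeries_smul, waveSeries_smul,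
      waveSeries_conv, waveSeries_cubic, waveSeries_coeffL1]
    push_cast
    ring
  · simp only [u]
    rw [planeWave_add_right, planeWave_shiftedPoint_period, isPeriodic_waveSeries Y s x]
    ring

end Solution

/-! ### The two-dimensional model -/

section Model

variable {n : ℕ}

/-- The product identity is the characteristic equation of the model; the inequalities follow from
`max (2ρ) |a - b| ≤ r ≤ 2ρ + |a - b|` for the square root `r`. -/
theorem model_eigenvalue_properties (a b ρ : ℝ) (hρ : 0 < ρ) :
    let Λ := (a + b) / 2 + Real.sqrt (4 * ρ ^ 2 + (a - b) ^ 2) / 2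
    (Λ - a) * (Λ - b) = ρ ^ 2 ∧ 0 < Λ - a ∧ 0 < Λ - b ∧ 2 * ρ ≤ 2 * Λ - a - b ∧
      Λ - a ≤ max 0 (b - a) + ρ := by
  intro Λ
  obtain ⟨r, hr⟩ : ∃ r, r = Real.sqrt (4 * ρ ^ 2 + (a - b) ^ 2) := ⟨_, rfl⟩
  have hΛ : Λ = (a + b) / 2 + r / 2 := by rw [hr]
  have hr0 : 0 ≤ r := hr ▸ Real.sqrt_nonneg _
  have hr2 : r ^ 2 = 4 * ρ ^ 2 + (a - b) ^ 2 := by rw [hr, Real.sq_sqrt (by positivity)]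
  have hab : |a - b| < r := abs_lt_of_sq_lt_sq (by nlinarith [sq_pos_of_pos hρ]) hr0
  rw [abs_lt] at hab
  have hρr : 2 * ρ ≤ r := abs_le_of_sq_le_sq' (by nlinarith [sq_nonneg (a - b)]) hr0 |>.2
  refine ⟨by rw [hΛ]; linear_combination hr2 / 4, by rw [hΛ]; linarith [hab.2],
    by rw [hΛ]; linarith [hab.1], by rw [hΛ]; linarith, ?_⟩
  have hle : r ≤ 2 * ρ + |a - b| := by
    refine abs_le_of_sq_le_sq' ?_ (by positivity) |>.2
    rw [hr2]
    nlinarith [sq_abs (a - b), mul_nonneg hρ.le (abs_nonneg (a - b))]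
  rw [hΛ]
  rcases le_total a b with h | h
  · rw [abs_of_nonpos (by linarith)] at hle
    rw [max_eq_right (by linarith)]
    linarith
  · rw [abs_of_nonneg (by linarith)] at hle
    rw [max_eq_left (by linarith)]
    linarith

theorem lambdaPlus_properties (l : ℕ) (v : (Fin n → ℤ) →₀ ℂ) (q j : Fin n → ℤ)
    (t : EuclideanSpace ℝ (Fin n)) (hq : v q ≠ 0) :
    (lambdaPlus l v q j t - freeEigenvalue l j t) *
      (lambdaPlus l v q j t - freeEigenvalue l (j - q) t) = ‖v q‖ ^ 2 ∧
    0 < lambdaPlus l v q j t - freeEigenvalue l j t ∧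
    0 < lambdaPlus l v q j t - freeEigenvalue l (j - q) t ∧
    2 * ‖v q‖ ≤ 2 * lambdaPlus l v q j t - freeEigenvalue l j t - freeEigenvalue l (j - q) t ∧
    lambdaPlus l v q j t - freeEigenvalue l j t ≤
      max 0 (freeEigenvalue l (j - q) t - freeEigenvalue l j t) + ‖v q‖ :=
  model_eigenvalue_properties _ _ _ (norm_pos_iff.2 hq)

/-- A normalized eigenvector of the model matrix, in terms of which `ψ₋₁` is written. -/
theorem exists_unit_modelEigenvector (l : ℕ) (v : (Fin n → ℤ) →₀ ℂ)
    (hv_real : ∀ q, v (-q) = (starRingEnd ℂ) (v q)) (q j : Fin n → ℤ)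
    (t : EuclideanSpace ℝ (Fin n)) (hq : v q ≠ 0) :
    ∃ e₀ e₁ : ℂ,
      (freeEigenvalue l j t : ℂ) * e₀ + v q * e₁ = lambdaPlus l v q j t * e₀ ∧
      v (-q) * e₀ + freeEigenvalue l (j - q) t * e₁ = lambdaPlus l v q j t * e₁ ∧
      ‖e₀‖ ^ 2 + ‖e₁‖ ^ 2 = 1 ∧
      ‖e₀‖ * ‖v q‖ ≤ lambdaPlus l v q j t - freeEigenvalue l (j - q) t ∧
      ∀ x, psiModel l v q j t x =
        (starRingEnd ℂ) e₀ * (e₀ + e₁ * planeWave (-latticePoint q) x) := by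
  obtain ⟨hprod, -, hb, -, -⟩ := lambdaPlus_properties l v q j t hq
  obtain ⟨a, ha⟩ : ∃ a, a = freeEigenvalue l j t := ⟨_, rfl⟩
  obtain ⟨b, hb'⟩ : ∃ b, b = freeEigenvalue l (j - q) t := ⟨_, rfl⟩
  obtain ⟨Λ, hΛ⟩ : ∃ Λ, Λ = lambdaPlus l v q j t := ⟨_, rfl⟩
  rw [← ha, ← hb', ← hΛ] at hprod
  rw [← hb', ← hΛ] at hb
  have hv0 : 0 < ‖v q‖ := norm_pos_iff.2 hq
  have hneg : ‖v (-q)‖ = ‖v q‖ := by rw [hv_real, RCLike.norm_conj]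
  obtain ⟨r, hr⟩ : ∃ r, r = Real.sqrt ((b - Λ) ^ 2 + ‖v q‖ ^ 2) := ⟨_, rfl⟩
  have hr2 : r ^ 2 = (b - Λ) ^ 2 + ‖v q‖ ^ 2 := by rw [hr, Real.sq_sqrt (by positivity)]
  have hr0 : 0 < r := by rw [hr]; exact Real.sqrt_pos.2 (by positivity)
  have hrc : (r : ℂ) ≠ 0 := by exact_mod_cast hr0.ne'
  have hvr : ‖v q‖ ≤ r := abs_le_of_sq_le_sq' (by nlinarith [sq_nonneg (b - Λ)]) hr0.le |>.2
  have hnr : ‖(r : ℂ)‖ = r := by rw [Complex.norm_real, Real.norm_of_nonneg hr0.le]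
  have hprodC : ((Λ : ℂ) - a) * (Λ - b) = v q * v (-q) := by
    rw [hv_real, Complex.mul_conj, Complex.normSq_eq_norm_sq, ← hprod]
    push_cast
    ring
  have hn₀ : ‖((b - Λ : ℝ) : ℂ)‖ = Λ - b := by
    rw [Complex.norm_real, Real.norm_eq_abs, abs_of_neg (by linarith)]
    ring
  have hsum : (∑ i, ‖modelEigenvector l v q j t i‖ ^ 2 : ℝ) = r ^ 2 := by
    rw [Fin.sum_univ_two]
    simp only [modelEigenvector, ← hb', ← hΛ, Matrix.cons_val_zero, Matrix.cons_val_one]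
    rw [hn₀, norm_neg, hneg, hr2]
    ring
  refine ⟨((b - Λ : ℝ) : ℂ) / r, -v (-q) / r, ?_, ?_, ?_, ?_, fun x => ?_⟩
  · rw [← ha, ← hΛ]
    field_simp
    push_cast
    linear_combination hprodC
  · rw [← hb', ← hΛ]
    field_simp
    push_cast
    ring
  · rw [norm_div, norm_div, hnr, hn₀, norm_neg, hneg, div_pow, div_pow, ← add_div,
      div_eq_one_iff_eq (by positivity), hr2]
    ring
  · rw [norm_div, hnr, hn₀, ← hb', ← hΛ, div_mul_eq_mul_div, div_le_iff₀ hr0]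
    exact mul_le_mul_of_nonneg_left hvr hb.le
  · rw [psiModel, modelProjection, hsum]
    simp only [modelEigenvector, ← hb', ← hΛ, Matrix.smul_apply, Matrix.vecMulVec_apply,
      Matrix.cons_val_zero, Matrix.cons_val_one, smul_eq_mul, Pi.star_apply, RCLike.star_def,
      map_div₀, Complex.conj_ofReal]
    push_cast
    field_simp

end Model

/-! ### Separation of the resonant pair from the other indices -/

section Gap

variable {n : ℕ}

theorem abs_sub_mul_pow_le {x y : ℝ} (hx : 0 ≤ x) (hy : 0 ≤ y) (l : ℕ) :
    |x - y| * x ^ l ≤ |x ^ (l + 1) - y ^ (l + 1)| := by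
  rcases le_total y x with h | h
  · rw [abs_of_nonneg (sub_nonneg.2 h), abs_of_nonneg (sub_nonneg.2 (pow_le_pow_left₀ hy h _))]
    have := mul_le_mul_of_nonneg_right (pow_le_pow_left₀ hy h l) hy
    rw [pow_succ, pow_succ]
    linarith
  · rw [abs_of_nonpos (sub_nonpos.2 h), abs_of_nonpos (sub_nonpos.2 (pow_le_pow_left₀ hx h _))]
    have := mul_le_mul_of_nonneg_right (pow_le_pow_left₀ hx h l) hy
    rw [pow_succ, pow_succ]
    linarith

theorem shiftedPoint_eq_add_sub (i : Fin n → ℤ) (t t₀ : EuclideanSpace ℝ (Fin n)) :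
    shiftedPoint i t = shiftedPoint i t₀ + (t - t₀) := by
  rw [shiftedPoint, shiftedPoint]
  abel

/-- The separation in the definition of a resonant index persists, with half the constant, for
quasimomenta at distance less than `k^{-n+1-7δ}`. -/
theorem IsResonantIndex.far_of_dist_lt (hn : 1 ≤ n) {q j : Fin n → ℤ} {k δ : ℝ} (hδ : 0 < δ)
    (hk : 4 ≤ k) (hkδ : 6 ≤ k ^ δ) {t t₀ : EuclideanSpace ℝ (Fin n)}
    (hres : IsResonantIndex q k δ t₀ j) (hdist : dist t t₀ < k ^ (-(n : ℝ) + 1 - 7 * δ)) :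
    k / 2 ≤ ‖shiftedPoint j t‖ ∧ ∀ i, i ≠ j → i ≠ j - q →
      k ^ (-(n : ℝ) + 2 - 6 * δ) ≤ |‖shiftedPoint j t‖ ^ 2 - ‖shiftedPoint i t‖ ^ 2| := by
  have hk0 : 0 < k := by linarith
  have hn1 : (1 : ℝ) ≤ n := by exact_mod_cast hn
  rw [dist_eq_norm] at hdist
  obtain ⟨y, hy⟩ : ∃ y, y = t - t₀ := ⟨_, rfl⟩
  rw [← hy] at hdist
  have hy1 : ‖y‖ ≤ 1 :=
    hdist.le.trans (Real.rpow_le_one_of_one_le_of_nonpos (by linarith) (by linarith))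
  have hshift : ∀ i, shiftedPoint i t = shiftedPoint i t₀ + y := fun i => by
    rw [hy]; exact shiftedPoint_eq_add_sub i t t₀
  have hlow : ∀ i, ‖shiftedPoint i t₀‖ - 1 ≤ ‖shiftedPoint i t‖ := fun i => by
    have := norm_sub_le (shiftedPoint i t) y
    rw [hshift i, add_sub_cancel_right] at this
    rw [hshift i]
    linarith
  have hup : ‖shiftedPoint j t‖ ≤ k + 1 := by
    have := norm_add_le (shiftedPoint j t₀) y
    rw [← hshift j, hres.norm_eq] at this
    linarith
  have hjlow := hlow j
  rw [hres.norm_eq] at hjlow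
  refine ⟨by linarith, fun i hi hi' => ?_⟩
  by_cases hbig : ‖shiftedPoint i t₀‖ ≤ 2 * k
  · have hfar := hres.far i hi hi'
    obtain ⟨X, hX⟩ : ∃ X, X = k ^ (-(n : ℝ) + 2 - 6 * δ) := ⟨_, rfl⟩
    rw [← hX] at hfar ⊢
    -- The term `‖y‖²` cancels, so the change is linear in `y`: at most `6 k^{-n+2-7δ}`, which `k ^
    -- δ ≥ 6` bounds by half of the original separation.
    have hinner : ‖shiftedPoint j t‖ ^ 2 - ‖shiftedPoint i t‖ ^ 2 =
        (‖shiftedPoint j t₀‖ ^ 2 - ‖shiftedPoint i t₀‖ ^ 2) +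
          2 * inner ℝ (shiftedPoint j t₀ - shiftedPoint i t₀) y := by
      rw [hshift i, hshift j, norm_add_sq_real, norm_add_sq_real, inner_sub_left]
      ring
    have hsmall : |2 * inner ℝ (shiftedPoint j t₀ - shiftedPoint i t₀) y| ≤ X := by
      have h1 := abs_real_inner_le_norm (shiftedPoint j t₀ - shiftedPoint i t₀) y
      have h2 : ‖shiftedPoint j t₀ - shiftedPoint i t₀‖ ≤ 3 * k := by
        have := norm_sub_le (shiftedPoint j t₀) (shiftedPoint i t₀)
        rw [hres.norm_eq] at this
        linarith
      have h3 : ‖shiftedPoint j t₀ - shiftedPoint i t₀‖ * ‖y‖ ≤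
          3 * k * k ^ (-(n : ℝ) + 1 - 7 * δ) := by gcongr
      have h4 : k * k ^ (-(n : ℝ) + 1 - 7 * δ) * k ^ δ = X := by
        have h5 : k * k ^ (-(n : ℝ) + 1 - 7 * δ) = k ^ (1 + (-(n : ℝ) + 1 - 7 * δ)) := by
          rw [Real.rpow_add hk0, Real.rpow_one]
        rw [hX, h5, ← Real.rpow_add hk0]
        congr 1
        ring
      have h5 : 0 < k * k ^ (-(n : ℝ) + 1 - 7 * δ) := by positivity
      rw [abs_mul, abs_two]
      nlinarith
    rw [hinner]
    have h6 := abs_sub_abs_le_abs_add (‖shiftedPoint j t₀‖ ^ 2 - ‖shiftedPoint i t₀‖ ^ 2)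
      (2 * inner ℝ (shiftedPoint j t₀ - shiftedPoint i t₀) y)
    linarith
  -- For remote `i` the difference of squares is itself of order `k²`, which exceeds the required
  -- power of `k`.
  · rw [not_le] at hbig
    have h1 : k ^ (-(n : ℝ) + 2 - 6 * δ) ≤ k ^ (2 : ℝ) :=
      Real.rpow_le_rpow_of_exponent_le (by linarith) (by linarith)
    rw [Real.rpow_two] at h1
    have h2 := hlow i
    have h3 : ‖shiftedPoint j t‖ ^ 2 ≤ (k + 1) ^ 2 :=
      pow_le_pow_left₀ (norm_nonneg _) hup 2
    have h4 : (2 * k - 1) ^ 2 ≤ ‖shiftedPoint i t‖ ^ 2 :=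
      pow_le_pow_left₀ (by linarith) (by linarith) 2
    rw [abs_sub_comm]
    refine le_trans ?_ (le_abs_self _)
    nlinarith

/-- The lower bound for the distance from `p_j^{2l}` to the other eigenvalues of the free
operator. -/
def spectralGap (n l : ℕ) (k δ : ℝ) : ℝ :=
  (1 / 4) ^ (l - 1) * k ^ (2 * (l : ℝ) - n - 6 * δ)

/-- Passing from squares to `2l`-th powers gains the factor `‖P_j(t)‖^{2(l-1)} ≥ (k²/4)^{l-1}`. -/
theorem IsResonantIndex.spectralGap_le (hn : 1 ≤ n) {l : ℕ} (hl : 1 ≤ l) {q j : Fin n → ℤ}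
    {k δ : ℝ} (hδ : 0 < δ) (hk : 4 ≤ k) (hkδ : 6 ≤ k ^ δ) {t t₀ : EuclideanSpace ℝ (Fin n)}
    (hres : IsResonantIndex q k δ t₀ j) (hdist : dist t t₀ < k ^ (-(n : ℝ) + 1 - 7 * δ))
    {i : Fin n → ℤ} (hi : i ≠ j) (hi' : i ≠ j - q) :
    spectralGap n l k δ ≤ |freeEigenvalue l j t - freeEigenvalue l i t| := by
  obtain ⟨hlow, hfar⟩ := hres.far_of_dist_lt hn hδ hk hkδ hdist
  have hk0 : 0 < k := by linarith
  obtain ⟨l, rfl⟩ : ∃ l', l = l' + 1 := ⟨l - 1, by omega⟩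
  rw [freeEigenvalue, freeEigenvalue, pow_mul, pow_mul]
  refine le_trans ?_ (abs_sub_mul_pow_le (sq_nonneg _) (sq_nonneg _) l)
  have h1 : (k ^ 2 / 4) ^ l ≤ (‖shiftedPoint j t‖ ^ 2) ^ l := by
    refine pow_le_pow_left₀ (by positivity) ?_ l
    nlinarith
  have h2 : spectralGap n (l + 1) k δ = k ^ (-(n : ℝ) + 2 - 6 * δ) * (k ^ 2 / 4) ^ l := by
    rw [spectralGap, Nat.add_sub_cancel, div_pow (k ^ 2), ← pow_mul,
      ← Real.rpow_natCast k (2 * l), mul_div_assoc', ← Real.rpow_add hk0, one_div, inv_pow,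
      inv_mul_eq_div]
    congr 2
    push_cast
    ring
  rw [h2]
  exact mul_le_mul (hfar i hi hi') h1 (by positivity) (abs_nonneg _)

/-- The exponent `2l - n - 6δ` of the gap exceeds `γ₁ = (2l - n)/2 - 4δ` by `(2l - n)/2 - 2δ > 0`,
and this surplus absorbs the constant `(1/4)^{l-1}`. -/
theorem exists_forall_gt_of_rpow (n l : ℕ) (δ L : ℝ) (hδ : 0 < δ)
    (hδl : 9 * δ < 2 * (l : ℝ) - n) :
    ∃ k₀ : ℝ, 1 ≤ k₀ ∧ ∀ k, k₀ < k → 4 ≤ k ∧ 6 ≤ k ^ δ ∧ L ≤ spectralGap n l k δ ∧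
      k ^ ((2 * (l : ℝ) - n) / 2 - 4 * δ) ≤ spectralGap n l k δ := by
  have hc : (0 : ℝ) < (1 / 4) ^ (l - 1) := by positivity
  have t1 : Filter.Tendsto (fun k : ℝ => spectralGap n l k δ) Filter.atTop Filter.atTop :=
    (tendsto_rpow_atTop (by linarith)).const_mul_atTop hc
  have t2 : Filter.Tendsto (fun k : ℝ => (1 / 4 : ℝ) ^ (l - 1) *
      k ^ ((2 * (l : ℝ) - n) / 2 - 2 * δ)) Filter.atTop Filter.atTop :=
    (tendsto_rpow_atTop (by linarith)).const_mul_atTop hc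
  have h := (Filter.eventually_ge_atTop (4 : ℝ)).and
    (((tendsto_rpow_atTop hδ).eventually_ge_atTop 6).and
      ((t1.eventually_ge_atTop L).and (t2.eventually_ge_atTop 1)))
  obtain ⟨k₀, hk₀⟩ := Filter.eventually_atTop.1 h
  refine ⟨max 1 k₀, le_max_left _ _, fun k hk => ?_⟩
  obtain ⟨h1, h2, h3, h4⟩ := hk₀ k ((le_max_right _ _).trans hk.le)
  refine ⟨h1, h2, h3, ?_⟩
  have hk0 : 0 < k := by linarith
  have h5 : spectralGap n l k δ = (1 / 4 : ℝ) ^ (l - 1) * k ^ ((2 * (l : ℝ) - n) / 2 - 2 * δ) *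
      k ^ ((2 * (l : ℝ) - n) / 2 - 4 * δ) := by
    rw [spectralGap, mul_assoc, ← Real.rpow_add hk0]
    congr 2
    ring
  rw [h5]
  exact le_mul_of_one_le_left (by positivity) h4

end Gap

/-! ### The main construction -/

section Main

variable {n : ℕ}

theorem exists_one_le_forall_inv_le (v : (Fin n → ℤ) →₀ ℂ) :
    ∃ C : ℝ, 1 ≤ C ∧ ∀ q, v q ≠ 0 → 1 ≤ C * ‖v q‖ := by
  refine ⟨1 + ∑ q ∈ v.support, ‖v q‖⁻¹, ?_, fun q hq => ?_⟩
  · have : 0 ≤ ∑ q ∈ v.support, ‖v q‖⁻¹ := Finset.sum_nonneg fun _ _ => by positivity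
    linarith
  · have h := Finset.single_le_sum (f := fun q => ‖v q‖⁻¹) (fun _ _ => by positivity)
      (Finsupp.mem_support_iff.2 hq)
    have hpos : 0 < ‖v q‖ := norm_pos_iff.2 hq
    rw [← div_le_iff₀ hpos, one_div]
    linarith

theorem refl_coeffL1 (v : (Fin n → ℤ) →₀ ℂ) (hv_real : ∀ q, v (-q) = (starRingEnd ℂ) (v q)) :
    L1.refl (coeffL1 v) = coeffL1 v :=
  L1.ext' fun m => by rw [L1.refl_apply, coeffL1_apply, coeffL1_apply, hv_real, Complex.conj_conj]

/-- The conclusion of the main theorem, for fixed data and an error bound `R`. -/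
def HasSolutionNearModel (l : ℕ) (v : (Fin n → ℤ) →₀ ℂ) (q j : Fin n → ℤ)
    (t : EuclideanSpace ℝ (Fin n)) (σ : ℝ) (A : ℂ) (R : ℝ) : Prop :=
  ∃ (u w : EuclideanSpace ℝ (Fin n) → ℂ) (lam : ℝ),
    IsSolution l (potential v) σ lam u ∧ IsQuasiPeriodic l t u ∧
    (∀ x, u x = A * planeWave (shiftedPoint j t) x * (psiModel l v q j t x + w x)) ∧
    |lam - lambdaPlus l v q j t| ≤ R ∧ Continuous w ∧ IsPeriodic w ∧
    starNorm w ≤ ENNReal.ofReal R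

/-- `A e^{i⟨P_j(t), x⟩}` times `β` times the function with coefficients `Y` is of the required form
if `β Y` is close to the coefficients of `ψ₋₁`. -/
theorem hasSolutionNearModel_of_eigenvector {l : ℕ} {v : (Fin n → ℤ) →₀ ℂ} {q j : Fin n → ℤ}
    {t : EuclideanSpace ℝ (Fin n)} {σ : ℝ} {A : ℂ} {R : ℝ} {e₀ e₁ : ℂ}
    (hψ : ∀ x, psiModel l v q j t x =
      (starRingEnd ℂ) e₀ * (e₀ + e₁ * planeWave (-latticePoint q) x))
    (Y : L1 (Fin n → ℤ)) (β : ℂ) (lam : ℝ)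
    (hY : ∀ m, ((freeEigenvalue l (j + m) t : ℂ) - lam) * Y m + L1.conv (coeffL1 v) Y m +
      (σ * ‖A * β‖ ^ 2 : ℝ) * L1.cubic Y m = 0)
    (hlam : |lam - lambdaPlus l v q j t| ≤ R)
    (hR : ‖β • Y - (starRingEnd ℂ) e₀ • (L1.single 0 e₀ + L1.single (-q) e₁)‖ ≤ R) :
    HasSolutionNearModel l v q j t σ A R := by
  obtain ⟨E, hE⟩ : ∃ E : L1 (Fin n → ℤ),
    E = (starRingEnd ℂ) e₀ • (L1.single 0 e₀ + L1.single (-q) e₁) := ⟨_, rfl⟩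
  rw [← hE] at hR
  have hψE : ∀ x, psiModel l v q j t x = waveSeries E latticePoint x := fun x => by
    rw [hψ, hE, waveSeries_smul, waveSeries_add, waveSeries_single, waveSeries_single,
      latticePoint_zero, planeWave_zero, latticePoint_neg, mul_one]
  obtain ⟨hsol, hper⟩ := isSolution_of_eigenvector l v j t Y lam σ (A * β) hY
  refine ⟨_, waveSeries (β • Y - E : L1 (Fin n → ℤ)) latticePoint, lam, hsol, hper, fun x => ?_,
    hlam, continuous_waveSeries (L1.summable_norm _), isPeriodic_waveSeries _, ?_⟩
  · rw [hψE, ← waveSeries_add, add_sub_cancel, waveSeries_smul]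
    ring
  · rw [starNorm_waveSeries]
    exact ENNReal.ofReal_le_ofReal hR

theorem norm_model_coefficients_le {q : Fin n → ℤ} {e₀ e₁ : ℂ}
    (hnorm : ‖e₀‖ ^ 2 + ‖e₁‖ ^ 2 = 1) :
    ‖(starRingEnd ℂ) e₀ • (L1.single 0 e₀ + L1.single (-q) e₁)‖ ≤ 2 * ‖e₀‖ := by
  have hn₀ : ‖e₀‖ ≤ 1 := by nlinarith [norm_nonneg e₀, sq_nonneg ‖e₁‖]
  have hn₁ : ‖e₁‖ ≤ 1 := by nlinarith [norm_nonneg e₁, sq_nonneg ‖e₀‖]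
  rw [norm_smul, RCLike.norm_conj]
  have h := norm_add_le (L1.single 0 e₀) (L1.single (-q) e₁)
  rw [L1.norm_single, L1.norm_single] at h
  nlinarith [norm_nonneg e₀]

/-- If `p_{j-q}^{2l}` exceeds `p_j^{2l}` by much more than `|v_q|`, then the column `ψ₋₁` of the
spectral projection is itself within the error bound, and the trivial solution will do. Nothing more
can be expected: in this range `λ̂⁺` is close to `p_{j-q}^{2l}`, which can coincide with a third
eigenvalue of the free operator and be split from it by the potential. -/
theorem hasSolutionNearModel_of_large_difference {l : ℕ} {v : (Fin n → ℤ) →₀ ℂ}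
    (hv_real : ∀ q, v (-q) = (starRingEnd ℂ) (v q)) {q j : Fin n → ℤ} (hq : v q ≠ 0)
    {t : EuclideanSpace ℝ (Fin n)} {σ : ℝ} {A : ℂ} {R : ℝ}
    (hd : 0 < freeEigenvalue l (j - q) t - freeEigenvalue l j t)
    (hR : 2 * ‖v q‖ ≤ R * (freeEigenvalue l (j - q) t - freeEigenvalue l j t)) :
    HasSolutionNearModel l v q j t σ A R := by
  obtain ⟨e₀, e₁, -, -, hnorm, he₀, hψ⟩ := exists_unit_modelEigenvector l v hv_real q j t hq
  obtain ⟨hprod, ha, hb, -, -⟩ := lambdaPlus_properties l v q j t hq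
  have hv0 : 0 < ‖v q‖ := norm_pos_iff.2 hq
  -- Multiply `‖e₀‖ |v_q| ≤ λ̂⁺ - p_{j-q}^{2l}` by the difference, which is at most `λ̂⁺ -
  -- p_j^{2l}`, and use the characteristic equation.
  have h1 : ‖e₀‖ * (freeEigenvalue l (j - q) t - freeEigenvalue l j t) ≤ ‖v q‖ := by
    have h2 : (‖e₀‖ * (freeEigenvalue l (j - q) t - freeEigenvalue l j t)) * ‖v q‖ ≤
        ‖v q‖ * ‖v q‖ := by
      calc _ = (‖e₀‖ * ‖v q‖) * (freeEigenvalue l (j - q) t - freeEigenvalue l j t) := by ring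
        _ ≤ (lambdaPlus l v q j t - freeEigenvalue l (j - q) t) *
            (lambdaPlus l v q j t - freeEigenvalue l j t) :=
          mul_le_mul he₀ (by linarith) hd.le hb.le
        _ = _ := by rw [mul_comm, hprod, sq]
    exact le_of_mul_le_mul_right h2 hv0
  have hRe : 2 * ‖e₀‖ ≤ R := by
    refine le_of_mul_le_mul_right ?_ hd
    linarith
  have hR0 : 0 ≤ R := by linarith [norm_nonneg e₀]
  refine hasSolutionNearModel_of_eigenvector hψ 0 0 (lambdaPlus l v q j t) (fun m => by simp)
    (by simpa using hR0) ?_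
  rw [zero_smul, zero_sub, norm_neg]
  exact (norm_model_coefficients_le hnorm).trans hRe

/-- The solution in the range where `λ̂⁺` is separated from all eigenvalues of the free operator
other than `p_j^{2l}`, `p_{j-q}^{2l}`, by the quantity `1 / g`. -/
theorem hasSolutionNearModel_of_separated {l : ℕ} {v : (Fin n → ℤ) →₀ ℂ} (hv_zero : v 0 = 0)
    (hv_real : ∀ q, v (-q) = (starRingEnd ℂ) (v q)) {q j : Fin n → ℤ} (hq : v q ≠ 0)
    {t : EuclideanSpace ℝ (Fin n)} {σ : ℝ} {A : ℂ} {ν C g ε : ℝ} (hν : 1 ≤ ν)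
    (hvν : ‖coeffL1 v‖ ≤ ν) (hC : 1 ≤ C) (hCv : 1 ≤ C * ‖v q‖) (hg0 : 0 ≤ g)
    (hfar : ∀ i, i ≠ j → i ≠ j - q →
      1 ≤ g * |freeEigenvalue l i t - lambdaPlus l v q j t|)
    (hg : 3072 * (C ^ 2 * ν ^ 3 * g) ≤ 1) (hε0 : 0 < ε) (hε : 8000 * (C ^ 2 * ν * ε) ≤ 1)
    (hσ : |σ| * ‖A‖ ^ 2 ≤ 1) :
    HasSolutionNearModel l v q j t σ A
      (216 * C * ν ^ 3 * (g + |σ| * ‖A‖ ^ 2) + 2 / ε * (|σ| * ‖A‖ ^ 2)) := by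
  obtain ⟨e₀, e₁, h₀, h₁, hnorm, -, hψ⟩ := exists_unit_modelEigenvector l v hv_real q j t hq
  obtain ⟨-, -, -, hgap, -⟩ := lambdaPlus_properties l v q j t hq
  have hn₀ : ‖e₀‖ ≤ 1 := by nlinarith [norm_nonneg e₀, sq_nonneg ‖e₁‖]
  obtain ⟨S, hS⟩ : ∃ S, S = |σ| * ‖A‖ ^ 2 := ⟨_, rfl⟩
  have hS0 : 0 ≤ S := by rw [hS]; positivity
  rw [← hS] at hσ ⊢
  have hε1 : ε ≤ 1 := by
    have h1 : 1 ≤ C ^ 2 * ν := one_le_mul_of_one_le_of_one_le (one_le_pow₀ hC) hν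
    have h2 : ε ≤ C ^ 2 * ν * ε := le_mul_of_one_le_left hε0.le h1
    linarith
  -- For a strong nonlinearity the amplitude is reduced by a constant factor.
  obtain ⟨κ, hκ0, hκ1, hκε, hκS⟩ : ∃ κ : ℝ, 0 < κ ∧ κ ≤ 1 ∧ κ ^ 2 * S ≤ ε ∧
      1 - κ ≤ S / ε := by
    by_cases h : S ≤ ε
    · exact ⟨1, one_pos, le_rfl, by linarith, by rw [sub_self]; positivity⟩
    · rw [not_le] at h
      refine ⟨Real.sqrt ε, Real.sqrt_pos.2 hε0, Real.sqrt_le_one.2 hε1, ?_, ?_⟩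
      · rw [Real.sq_sqrt hε0.le]
        exact mul_le_of_le_one_right hε0.le hσ
      · have h1 : 1 ≤ S / ε := by rw [le_div_iff₀ hε0]; linarith
        linarith [Real.sqrt_nonneg ε]
  -- The factor `conj e₀` is the one that turns the unit eigenvector into the column `ψ₋₁`.
  obtain ⟨β, hβ⟩ : ∃ β : ℂ, β = κ * (starRingEnd ℂ) e₀ := ⟨_, rfl⟩
  have hnκ : ‖(κ : ℂ)‖ = κ := by rw [Complex.norm_real, Real.norm_of_nonneg hκ0.le]
  have hnβ : ‖β‖ = κ * ‖e₀‖ := by rw [hβ, norm_mul, hnκ, RCLike.norm_conj]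
  obtain ⟨τ, hτ⟩ : ∃ τ : ℝ, τ = σ * ‖A * β‖ ^ 2 := ⟨_, rfl⟩
  have hτ' : |τ| = ‖e₀‖ ^ 2 * (κ ^ 2 * S) := by
    rw [hτ, norm_mul, hnβ, abs_mul, abs_of_nonneg (sq_nonneg (‖A‖ * (κ * ‖e₀‖))), hS]
    ring
  have he2 : ‖e₀‖ ^ 2 ≤ 1 := pow_le_one₀ (norm_nonneg _) hn₀
  have hτκ : |τ| ≤ κ ^ 2 * S := by
    rw [hτ']
    exact mul_le_of_le_one_left (by positivity) he2
  have hτS : |τ| ≤ S :=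
    hτκ.trans (mul_le_of_le_one_left hS0 (pow_le_one₀ hκ0.le hκ1))
  have hτε : 8000 * (C ^ 2 * ν * |τ|) ≤ 1 := by
    have : C ^ 2 * ν * |τ| ≤ C ^ 2 * ν * ε := by
      have := hτκ.trans hκε
      gcongr
    linarith
  have hq0 : q ≠ 0 := by
    rintro rfl
    exact hq hv_zero
  obtain ⟨Y, lam, heq, hYe, hlam⟩ := exists_nonlinear_eigenvector (coeffL1 v) hv_zero
    (refl_coeffL1 v hv_real) q hq0 (fun m => freeEigenvalue l (j + m) t) e₀ e₁
    (lambdaPlus l v q j t) τ ν C g (by simpa using h₀)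
    (by simpa [← sub_eq_add_neg] using h₁) hnorm hν hvν hC
    (by
      rw [add_zero, ← sub_eq_add_neg]
      have := mul_le_mul_of_nonneg_left hgap (by linarith : 0 ≤ C)
      linarith) hg0
    (fun m hm hm' => hfar (j + m) (by simpa using hm) (fun h => hm' (by
      rw [sub_eq_add_neg] at h
      exact add_left_cancel h))) hg hτε
  obtain ⟨K, hK⟩ : ∃ K, K = 216 * C * ν ^ 3 := ⟨_, rfl⟩
  have hK0 : 0 ≤ K := by rw [hK]; positivity
  rw [← hK] at hYe hlam ⊢
  have hKle : K * (g + |τ|) ≤ K * (g + S) := by gcongr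
  have hSε : 2 / ε * S = 2 * (S / ε) := by ring
  have hSε0 : 0 ≤ S / ε := by positivity
  refine hasSolutionNearModel_of_eigenvector hψ Y β lam (fun m => by rw [← hτ]; exact heq m)
    (by linarith) ?_
  obtain ⟨e, he⟩ : ∃ e : L1 (Fin n → ℤ), e = L1.single 0 e₀ + L1.single (-q) e₁ := ⟨_, rfl⟩
  have hmodel := norm_model_coefficients_le (q := q) hnorm
  rw [← he] at hYe hmodel ⊢
  have hdec : β • Y - (starRingEnd ℂ) e₀ • e =
      β • (Y - e) - ((1 - κ : ℝ) : ℂ) • ((starRingEnd ℂ) e₀ • e) := by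
    rw [hβ, smul_sub, smul_smul, ← sub_eq_zero]
    push_cast
    module
  rw [hdec]
  refine (norm_sub_le _ _).trans ?_
  rw [norm_smul, norm_smul, hnβ, Complex.norm_real, Real.norm_of_nonneg (by linarith : 0 ≤ 1 - κ)]
  have h1 : κ * ‖e₀‖ * ‖Y - e‖ ≤ K * (g + S) := by
    have : κ * ‖e₀‖ ≤ 1 := mul_le_one₀ hκ1 (norm_nonneg _) hn₀
    exact (mul_le_of_le_one_left (norm_nonneg _) this).trans (hYe.trans hKle)
  have h2 : (1 - κ) * ‖(starRingEnd ℂ) e₀ • e‖ ≤ (S / ε) * 2 :=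
    mul_le_mul hκS (by linarith) (norm_nonneg _) hSε0
  linarith

theorem HasSolutionNearModel.mono {l : ℕ} {v : (Fin n → ℤ) →₀ ℂ} {q j : Fin n → ℤ}
    {t : EuclideanSpace ℝ (Fin n)} {σ : ℝ} {A : ℂ} {R R' : ℝ}
    (h : HasSolutionNearModel l v q j t σ A R) (hR : R ≤ R') :
    HasSolutionNearModel l v q j t σ A R' := by
  obtain ⟨u, w, lam, h1, h2, h3, h4, h5, h6, h7⟩ := h
  exact ⟨u, w, lam, h1, h2, h3, h4.trans hR, h5, h6, h7.trans (ENNReal.ofReal_le_ofReal hR)⟩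

end Main

end Polyharmonic

end

open Polyharmonic in
theorem theorem3 (n l : ℕ) (hln : n < 2 * l) (v : (Fin n → ℤ) →₀ ℂ) (hv_zero : v 0 = 0)
    (hv_real : ∀ q, v (-q) = (starRingEnd ℂ) (v q)) :
    ∃ c : ℝ, 0 < c ∧ ∀ δ : ℝ, 0 < δ → 9 * δ < 2 * (l : ℝ) - n →
      ∃ k₀ : ℝ, 1 ≤ k₀ ∧ ∀ k : ℝ, k₀ < k →
        ∀ q : Fin n → ℤ, v q ≠ 0 →
        ∀ t ∈ Polyharmonic.dualCell n,
        ∀ t₀ ∈ Polyharmonic.resonantSet q k δ, dist t t₀ < k ^ (-(n : ℝ) + 1 - 7 * δ) →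
        ∀ j : Fin n → ℤ, Polyharmonic.IsResonantIndex q k δ t₀ j →
        ∀ γ₂ : ℝ, 0 < γ₂ →
        ∀ (σ : ℝ) (A : ℂ), |σ| * ‖A‖ ^ 2 < k ^ (-(2 * (l : ℝ) * γ₂)) →
        ∃ (u w : EuclideanSpace ℝ (Fin n) → ℂ) (lam : ℝ),
          Polyharmonic.IsSolution l (Polyharmonic.potential v) σ lam u ∧
          Polyharmonic.IsQuasiPeriodic l t u ∧
          (∀ x, u x = A * Polyharmonic.planeWave (Polyharmonic.shiftedPoint j t) x *
            (Polyharmonic.psiModel l v q j t x + w x)) ∧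
          |lam - Polyharmonic.lambdaPlus l v q j t| ≤
            c * k ^ (-(min ((2 * (l : ℝ) - n) / 2 - 4 * δ) (2 * (l : ℝ) * γ₂))) ∧
          Continuous w ∧ Polyharmonic.IsPeriodic w ∧
          Polyharmonic.starNorm w ≤ ENNReal.ofReal
            (c * k ^ (-(min ((2 * (l : ℝ) - n) / 2 - 4 * δ) (2 * (l : ℝ) * γ₂)))) := by
  obtain ⟨C, hC, hCv⟩ := exists_one_le_forall_inv_le v
  obtain ⟨ν, hν⟩ : ∃ ν, ν = max 1 ‖coeffL1 v‖ := ⟨_, rfl⟩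
  have hν1 : 1 ≤ ν := hν ▸ le_max_left _ _
  have hvν : ‖coeffL1 v‖ ≤ ν := hν ▸ le_max_right _ _
  have hCν : 1 ≤ C ^ 2 * ν := one_le_mul_of_one_le_of_one_le (one_le_pow₀ hC) hν1
  obtain ⟨ε, hε⟩ : ∃ ε, ε = 1 / (8000 * (C ^ 2 * ν)) := ⟨_, rfl⟩
  have hε0 : 0 < ε := by rw [hε]; positivity
  have hε' : 8000 * (C ^ 2 * ν * ε) ≤ 1 := by
    rw [hε]
    exact le_of_eq (by field_simp)
  obtain ⟨K, hK⟩ : ∃ K, K = 216 * C * ν ^ 3 := ⟨_, rfl⟩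
  have hK0 : 0 < K := by rw [hK]; positivity
  -- The summands pay for the reduction error (`2/G ≤ 2r` and `|σ||A|² ≤ r`), the reduced amplitude,
  -- and the case of a large difference, in that order.
  refine ⟨3 * K + 2 / ε + 8 * ν, by positivity, fun δ hδ hδl => ?_⟩
  -- `6144 = 2 * 3072`, because the reduction is applied with `g = 2 / G`.
  obtain ⟨k₀, hk₀, hlarge⟩ := exists_forall_gt_of_rpow n l δ (6144 * (C ^ 2 * ν ^ 3)) hδ hδl
  refine ⟨k₀, hk₀, ?_⟩
  intro k hk q hq t _ t₀ _ hdist j hres γ₂ hγ₂ σ A hσ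
  obtain ⟨hk4, hkδ, hGL, hGγ⟩ := hlarge k hk
  have hk1 : 1 ≤ k := by linarith
  have hk0 : 0 < k := by linarith
  have hn : 1 ≤ n := by
    rcases Nat.eq_zero_or_pos n with rfl | h
    · exact absurd (by rw [Subsingleton.elim q 0]; exact hv_zero) hq
    · exact h
  have hl : 1 ≤ l := by omega
  obtain ⟨G, hG⟩ : ∃ G, G = spectralGap n l k δ := ⟨_, rfl⟩
  rw [← hG] at hGL hGγ
  obtain ⟨r, hr⟩ : ∃ r, r = k ^ (-(min ((2 * (l : ℝ) - n) / 2 - 4 * δ) (2 * (l : ℝ) * γ₂))) :=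
    ⟨_, rfl⟩
  rw [← hr]
  have hr0 : 0 < r := by rw [hr]; positivity
  have hrσ : |σ| * ‖A‖ ^ 2 ≤ r := by
    refine hσ.le.trans ?_
    rw [hr]
    exact Real.rpow_le_rpow_of_exponent_le hk1 (neg_le_neg (min_le_right _ _))
  have hσ1 : |σ| * ‖A‖ ^ 2 ≤ 1 :=
    hσ.le.trans (Real.rpow_le_one_of_one_le_of_nonpos hk1 (by
      have : 0 ≤ 2 * (l : ℝ) * γ₂ := by positivity
      linarith))
  have hrG : 1 ≤ r * G := by
    have h1 : k ^ (-((2 * (l : ℝ) - n) / 2 - 4 * δ)) ≤ r := by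
      rw [hr]
      exact Real.rpow_le_rpow_of_exponent_le hk1 (neg_le_neg (min_le_left _ _))
    calc (1 : ℝ) = k ^ (-((2 * (l : ℝ) - n) / 2 - 4 * δ)) *
            k ^ ((2 * (l : ℝ) - n) / 2 - 4 * δ) := by
          rw [← Real.rpow_add hk0, neg_add_cancel, Real.rpow_zero]
      _ ≤ r * G := by gcongr
  have hνG : 4 * ν ≤ G := by
    have h1 : ν * 1 ≤ ν * (C ^ 2 * ν * ν) := by
      gcongr
      exact one_le_mul_of_one_le_of_one_le hCν hν1
    have h2 : 0 ≤ ν * (C ^ 2 * ν * ν) := by positivity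
    linarith
  have hG0 : 0 < G := by linarith
  have hvq : ‖v q‖ ≤ ν := (L1.norm_apply_le (coeffL1 v) q).trans hvν
  change HasSolutionNearModel l v q j t σ A ((3 * K + 2 / ε + 8 * ν) * r)
  -- The resonance condition allows `p_{j-q}^{2l} - p_j^{2l}` up to order `k^{2l-n-δ}`, far above
  -- `G`, so both cases can occur.
  by_cases hd : freeEigenvalue l (j - q) t - freeEigenvalue l j t ≤ G / 4
  · obtain ⟨-, ha, -, -, hΛ⟩ := lambdaPlus_properties l v q j t hq
    have hΛ' : lambdaPlus l v q j t - freeEigenvalue l j t ≤ G / 2 := by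
      have : max 0 (freeEigenvalue l (j - q) t - freeEigenvalue l j t) ≤ G / 4 :=
        max_le (by positivity) hd
      linarith
    have hfar : ∀ i, i ≠ j → i ≠ j - q →
        1 ≤ 2 / G * |freeEigenvalue l i t - lambdaPlus l v q j t| := fun i hi hi' => by
      have h1 := hres.spectralGap_le hn hl hδ hk4 hkδ hdist hi hi'
      rw [← hG] at h1
      have h2 := abs_sub_le (freeEigenvalue l j t) (lambdaPlus l v q j t) (freeEigenvalue l i t)
      rw [abs_sub_comm _ (lambdaPlus l v q j t), abs_of_pos ha, abs_sub_comm (lambdaPlus l v q j t)]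
        at h2
      rw [div_mul_eq_mul_div, le_div_iff₀ hG0]
      linarith
    have hg : 3072 * (C ^ 2 * ν ^ 3 * (2 / G)) ≤ 1 := by
      rw [mul_div_assoc', mul_div_assoc', div_le_iff₀ hG0]
      linarith
    have h := hasSolutionNearModel_of_separated hv_zero hv_real hq hν1 hvν hC (hCv q hq)
      (by positivity) hfar hg hε0 hε' hσ1
    refine h.mono ?_
    rw [← hK]
    have h1 : 2 / G ≤ 2 * r := by
      rw [div_le_iff₀ hG0]
      linarith
    have h2 : K * (2 / G + |σ| * ‖A‖ ^ 2) ≤ K * (2 * r + r) := by gcongr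
    have h3 : 2 / ε * (|σ| * ‖A‖ ^ 2) ≤ 2 / ε * r := by gcongr
    have h4 : 0 ≤ 8 * ν * r := by positivity
    linarith
  · rw [not_le] at hd
    refine hasSolutionNearModel_of_large_difference hv_real hq (by linarith) ?_
    have h1 : 8 * ν * r * (G / 4) ≤ (3 * K + 2 / ε + 8 * ν) * r *
        (freeEigenvalue l (j - q) t - freeEigenvalue l j t) := by
      gcongr
      have : 0 ≤ 3 * K + 2 / ε := by positivity
      linarith
    have h2 : ν * 1 ≤ ν * (r * G) := by gcongr
    linarith
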